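/- For $b_1,\dots,b_k\in\mathbb C$ and a $C^1$ path $\gamma:[0,1]\to\mathbb C$ avoiding $b_1,\dots,b_k$, put $$J_\gamma[b_1,\dots,b_k]=(-1)^k\int_{0\le u_1\le\dots\le u_k\le 1}\prod_{m=1}^k\frac{\gamma'(u_m)}{\gamma(u_m)-b_m}\,du_1\cdots du_k ,\qquad J_\gamma[\,]=1 .$$ Let $x,y,z\in\mathbb C$ with $x,y,z\ne 0$ and $x,\,y,\,z,\,xy,\,yz,\,xyz\neq 1$, and put $a_0=0$, $a_1=\frac1{xyz}$, $a_2=\frac1{yz}$, $a_3=\frac1z$, $a_4=1$. Order $\mathfrak S_3=\{0,1\}^3$ as $000,001,010,100,011,101,110,111$, with weights $|{\bf j}|=j_1+j_2+j_3$. For ${\bf j}\in\mathfrak S_3$ let $t_1<\dots<t_l$ be the positions of the ones of ${\bf j}$, and $t_0=0$, $t_{l+1}=4$. Choose, for each ${\bf j}$ and each $0\le r\le l$, a $C^1$ path $p_{{\bf j},r}$ from $a_{t_r}$ to $a_{t_{r+1}}$ in $\mathbb C\setminus\{a_s: t_r<s<t_{r+1}\}$; such choices exist. Let $L=(E_{{\bf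 i},{\bf j}})$ be the $8\times 8$ matrix with $E_{{\bf i},{\bf j}}=0$ unless ${\bf j}\le{\bf i}$ componentwise, and in that case $$E_{{\bf i},{\bf j}}=\prod_{r=0}^{l}J_{p_{{\bf j},r}}\big[a_s:\ t_r<s<t_{r+1},\ i_s=1\big]\qquad(s\text{ increasing}).$$ (Thus $E_{111,000}$ is a value of the multivalued function $Li_{1,1,1}(x,y,z)$, which continues $\sum_{0<k_1<k_2<k_3}\frac{x^{k_1}y^{k_2}z^{k_3}}{k_1k_2k_3}$.) Let $\tau(c)=\mathrm{diag}\big(c^{|{\bf j}|}\big)$, $M=L\,\tau(2\pi i)$ and $B=\tau(i)\,M\,\overline{M}^{\,-1}\,\tau(i)$. The matrix $B$ is unipotent lower triangular with $(B-1)^4=0$, so that $\log B=(B-1)-\frac12(B-1)^2+\frac13(B-1)^3$. Define the single-valued triple logarithm $$\mathcal L_{1,1,1}(x,y,z)=-\frac1{2i}\,(\log B)_{111,000},$$ and define the single-valued trilogarithm, with the principal branches of $Li_2$ and $Li_3$, by $$\mathcal L_3(w)=\mathrm{Re}\,Li_3(w)-\log|w|\,\mathrm{Re}\,Li_2(w)-\tfrac13(\log|w|)^2\log|1-w|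 .$$ Then, for every choice of the paths (in particular $\mathcal L_{1,1,1}(x,y,z)$ is real and does not depend on the choice), $$\begin{aligned} \mathcal L_{1,1,1}(x,y,z)={}&\mathcal L_3\Bigl(\frac{(y-1)(1-xyz)}{y(1-x)(1-z)}\Bigr)+\mathcal L_3\Bigl(\frac{y}{y-1}\Bigr)+\mathcal L_3(xy)-\mathcal L_3\Bigl(\frac{1-xyz}{1-x}\Bigr)\\ &-\mathcal L_3\Bigl(\frac{1-xyz}{xy(1-z)}\Bigr)-\mathcal L_3\Bigl(\frac{y-yz}{y-1}\Bigr)-\mathcal L_3\Bigl(\frac{y-xy}{y-1}\Bigr)+\mathcal L_3(1-x). \end{aligned}$$ -/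

import Mathlib

namespace TripleLog

noncomputable section

/-! ### Chen iterated integrals -/

/-- The iterated integral `∫_γ dt/(t-b₁) dt/(t-b₂) ⋯ dt/(t-b_k)` along `γ` restricted to `[0, s]`,
as a function of `s`, for `l = [b₁, …, b_k]`. The first form is the innermost one:
for `k = 2` it is `∫_{0 ≤ u₁ ≤ u₂ ≤ s} γ'(u₁)/(γ(u₁)-b₁) · γ'(u₂)/(γ(u₂)-b₂) du₁ du₂`.
The empty iterated integral is `1`. -/
def iterInt (γ : ℝ → ℂ) (l : List ℂ) : ℝ → ℂ :=
  l.foldl (fun F b s => ∫ u in (0 : ℝ)..s, F u * (deriv γ u / (γ u - b))) (fun _ => 1)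

/-- The signed iterated integral `(-1)^k ∫_γ dt/(t-b₁) ⋯ dt/(t-b_k)` over the whole path
`γ : [0, 1] → ℂ`. -/
def J (γ : ℝ → ℂ) (l : List ℂ) : ℂ :=
  (-1) ^ l.length * iterInt γ l 1

/-! ### The variation matrix of the triple logarithm -/

/-- The points `a₀ = 0`, `a₁ = 1/(xyz)`, `a₂ = 1/(yz)`, `a₃ = 1/z`, `a₄ = 1`. -/
def nodes (x y z : ℂ) : Fin 5 → ℂ :=
  ![0, (x * y * z)⁻¹, (y * z)⁻¹, z⁻¹, 1]

/-- `γ` is a continuously differentiable path (parametrised by `[0, 1]`) from `a s` to `a t` in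
the complex plane punctured at the points `a m` with `s < m < t`. -/
structure IsPath (a : Fin 5 → ℂ) (s t : Fin 5) (γ : ℝ → ℂ) : Prop where
  contDiff : ContDiff ℝ 1 γ
  source : γ 0 = a s
  target : γ 1 = a t
  avoids : ∀ u ∈ Set.Icc (0 : ℝ) 1, ∀ m : Fin 5, s < m → m < t → γ u ≠ a m

/-- A choice of integration paths at the point `(x, y, z)`: for every column `c` of the variation
matrix and all `s < t`, a path `p c s t` from `a s` to `a t` as in `IsPath`. The paths may be chosen
differently in different columns, but within a column they do not depend on the row. -/
def IsPathSystem (x y z : ℂ) (p : Fin 8 → Fin 5 → Fin 5 → ℝ → ℂ) : Prop :=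
  ∀ c s t, s < t → IsPath (nodes x y z) s t (p c s t)

/-- The weights `|j|` of the indices `j ∈ {0,1}³`, ordered as
`000, 001, 010, 100, 011, 101, 110, 111`. -/
def weight : Fin 8 → ℕ := ![0, 1, 1, 1, 2, 2, 2, 3]

/-- The diagonal matrix `τ(c) = diag(c^|j|)`. -/
def tau (c : ℂ) : Matrix (Fin 8) (Fin 8) ℂ :=
  Matrix.diagonal fun j => c ^ weight j

/-- The matrix `L(x,y,z) = (E_{i,j})`, rows and columns being ordered as in `weight`.
For `j ≤ i`, if `t₁ < ⋯ < t_l` are the positions of the ones of `j`, `t₀ = 0`, `t_{l+1} = 4`, then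
`E_{i,j}` is the product over `r = 0, …, l` of the signed iterated integrals, along the path of
column `j` from `a_{t_r}` to `a_{t_{r+1}}`, of the forms `dt/(t - a_s)` in increasing order of `s`,
where `s` runs through the positions of the ones of `i` with `t_r < s < t_{r+1}`.
All other entries are `0`. The first column consists of the (multivalued) functions
`1`, `Li₁(z)`, `Li₁(yz)`, `Li₁(xyz)`, `Li₁,₁(y,z)`, `Li₁,₁(xy,z)`, `Li₁,₁(x,yz)`,
`Li₁,₁,₁(x,y,z)`. -/
def matL (x y z : ℂ) (p : Fin 8 → Fin 5 → Fin 5 → ℝ → ℂ) : Matrix (Fin 8) (Fin 8) ℂ :=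
  let a₁ := nodes x y z 1
  let a₂ := nodes x y z 2
  let a₃ := nodes x y z 3
  !![1, 0, 0, 0, 0, 0, 0, 0;
     J (p 0 0 4) [a₃], 1, 0, 0, 0, 0, 0, 0;
     J (p 0 0 4) [a₂], 0, 1, 0, 0, 0, 0, 0;
     J (p 0 0 4) [a₁], 0, 0, 1, 0, 0, 0, 0;
     J (p 0 0 4) [a₂, a₃], J (p 1 0 3) [a₂], J (p 2 2 4) [a₃], 0, 1, 0, 0, 0;
     J (p 0 0 4) [a₁, a₃], J (p 1 0 3) [a₁], 0, J (p 3 1 4) [a₃], 0, 1, 0, 0;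
     J (p 0 0 4) [a₁, a₂], 0, J (p 2 0 2) [a₁], J (p 3 1 4) [a₂], 0, 0, 1, 0;
     J (p 0 0 4) [a₁, a₂, a₃], J (p 1 0 3) [a₁, a₂],
       J (p 2 0 2) [a₁] * J (p 2 2 4) [a₃], J (p 3 1 4) [a₂, a₃],
       J (p 4 0 2) [a₁], J (p 5 1 3) [a₂], J (p 6 2 4) [a₃], 1]

/-- The variation matrix `M = L τ(2πi)`. -/
def matM (x y z : ℂ) (p : Fin 8 → Fin 5 → Fin 5 → ℝ → ℂ) : Matrix (Fin 8) (Fin 8) ℂ :=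
  matL x y z p * tau (2 * Real.pi * Complex.I)

/-- `B = τ(i) M M̄⁻¹ τ(i)`. -/
def matB (x y z : ℂ) (p : Fin 8 → Fin 5 → Fin 5 → ℝ → ℂ) : Matrix (Fin 8) (Fin 8) ℂ :=
  tau Complex.I * matM x y z p * ((matM x y z p).map (starRingEnd ℂ))⁻¹ * tau Complex.I

/-- The logarithm of a unipotent matrix `B` with `(B - 1)⁴ = 0`, by its (finite) power series. -/
def unipotentLog (B : Matrix (Fin 8) (Fin 8) ℂ) : Matrix (Fin 8) (Fin 8) ℂ :=
  (B - 1) - (1 / 2 : ℂ) • (B - 1) ^ 2 + (1 / 3 : ℂ) • (B - 1) ^ 3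

/-- The single-valued triple logarithm `ℒ₁,₁,₁(x,y,z)`, computed with the paths `p`:
`-1/(2i)` times the lower left corner entry of `log B`. -/
def svLi111 (x y z : ℂ) (p : Fin 8 → Fin 5 → Fin 5 → ℝ → ℂ) : ℂ :=
  -1 / (2 * Complex.I) * unipotentLog (matB x y z p) 7 0

/-! ### The single-valued trilogarithm -/

/-- The principal branch of the dilogarithm, `Li₂(z) = -∫₀¹ log(1-tz)/t dt`. -/
def Li2 (z : ℂ) : ℂ :=
  -∫ t in (0 : ℝ)..1, Complex.log (1 - t * z) / t

/-- The principal branch of the trilogarithm, `Li₃(z) = ∫₀¹ Li₂(tz)/t dt`. -/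
def Li3 (z : ℂ) : ℂ :=
  ∫ t in (0 : ℝ)..1, Li2 (t * z) / t

/-- The single-valued trilogarithm
`ℒ₃(z) = Re Li₃(z) - log|z| Re Li₂(z) - (1/3) (log|z|)² log|1-z|`. -/
def svLi3 (z : ℂ) : ℝ :=
  (Li3 z).re - Real.log ‖z‖ * (Li2 z).re - 1 / 3 * Real.log ‖z‖ ^ 2 * Real.log ‖1 - z‖

end

end TripleLog

namespace TripleLog

/-! ### Integration along rays -/

/-! The algebra turns the corner of `log B` into a real polynomial in the entries of `L`; the
analysis shows by differentiation that this polynomial is the stated sum of trilogarithms. Algebra.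
With N = τ(i) L τ(-i) one has B = N N̄⁻¹. Split N = (1 + q)A, where A = Re N is real unipotent and q
is purely imaginary and nilpotent. Then N̄ = (1 - q)A, so A cancels, B is the Cayley transform (1 +
q)(1 - q)⁻¹, and log B = 2 artanh q = 2(q + q³/3). The corner entry is therefore explicit and real
(`neg_half_mul_unipotentLog_apply`). Low weight. Real parts of simple integrals are differences of
log|·|, independent of the path (`re_iterInt_one`). Imaginary parts of double integrals are values
of the Bloch–Wigner function D up to products of imaginary parts of simple integrals with logarithms
(`im_iterInt_two`). In the corner polynomial these products cancel in columns 001 and 100, so the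
imaginary parts of the first column get path-independent coefficients; the coefficient coming from
column 010 is zero. Weight three. Let the upper end point of the path from 0 to 1 vary, which
replaces z by zγ(s). The difference between the two sides becomes `tripleDefect`. It vanishes at s =
0 by the inversion relation ℒ₃(1/w) = ℒ₃(w), and its derivative is zero: the logarithmic terms match
identically, and the D-terms match by the five-term relation (`blochWigner_five_term`). Hence it
vanishes at s = 1 (`re_iterInt_three`). For this D and ℒ₃ must be differentiable along every curve
avoiding 0 and 1, including curves crossing the cut of the principal branches; inversion, which
carries (1,∞) into (0,1), provides that (`hasDerivAt_blochWigner`, `hasDerivAt_svLi3`). -/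

theorem div_eq_mul_dslope {f : ℂ → ℂ} (h0 : f 0 = 0) (w : ℂ) {t : ℝ} (ht : t ≠ 0) :
    f (t * w) / t = w * dslope f 0 (t * w) := by
  have ht' : (t : ℂ) ≠ 0 := by exact_mod_cast ht
  rcases eq_or_ne w 0 with rfl | hw
  · simp [h0]
  · rw [dslope_of_ne _ (mul_ne_zero ht' hw), slope_def_field, h0, sub_zero, sub_zero]
    field_simp

section ray

variable {f : ℂ → ℂ} {U : Set ℂ} (hU : IsOpen U)
  (hst : ∀ w ∈ U, ∀ t ∈ Set.Icc (0 : ℝ) 1, (t : ℂ) * w ∈ U)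
  (hf : DifferentiableOn ℂ f U) (h0 : f 0 = 0)

-- When f 0 = 0, `div_eq_mul_dslope` identifies this function with f(tw)/t for t ≠ 0, so the ray
-- integrals have only a removable singularity at t = 0.
include hU hst hf in
theorem continuousOn_dslope_ray {w : ℂ} (hw : w ∈ U) :
    ContinuousOn (fun t : ℝ => w * dslope f 0 (t * w)) (Set.Icc 0 1) := by
  have h0U : (0 : ℂ) ∈ U := by simpa using hst w hw 0 (by simp)
  have h1 : ContinuousOn (dslope f 0) U :=
    (continuousOn_dslope (hU.mem_nhds h0U)).2
      ⟨hf.continuousOn, hf.differentiableAt (hU.mem_nhds h0U)⟩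
  refine continuousOn_const.mul (h1.comp (by fun_prop) ?_)
  intro t ht
  exact hst w hw t ht

include hU hst hf h0 in
theorem intervalIntegrable_ray {w : ℂ} (hw : w ∈ U) :
    IntervalIntegrable (fun t : ℝ => f (t * w) / t) MeasureTheory.volume 0 1 := by
  have h := (continuousOn_dslope_ray hU hst hf hw)
  rw [← Set.uIcc_of_le zero_le_one] at h
  refine h.intervalIntegrable.congr ?_
  intro t ht
  rw [Set.uIoc_of_le zero_le_one] at ht
  exact (div_eq_mul_dslope h0 w ht.1.ne').symm

-- Differentiating f(tv)/t in v cancels the 1/t. Together with `mul_integral_deriv_ray` the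
-- derivative of the ray integral is f(w)/w; this is used with f = -log(1-w) to get `Li2` and with f
-- = `Li2` to get `Li3`.
include hU hst hf h0 in
theorem hasDerivAt_integral_ray {w : ℂ} (hw : w ∈ U) :
    HasDerivAt (fun v => ∫ t in (0 : ℝ)..1, f (t * v) / t)
      (∫ t in (0 : ℝ)..1, deriv f (t * w)) w := by
  obtain ⟨r, hr, hrU⟩ := Metric.nhds_basis_closedBall.mem_iff.1 (hU.mem_nhds hw)
  have hd : ContinuousOn (deriv f) U := (hf.deriv hU).continuousOn
  -- The segments from 0 to the points of the closed ball sweep out a compact subset of U; a bound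
  -- for `deriv f` there is the dominating constant.
  have hK : IsCompact ((fun p : ℝ × ℂ => (p.1 : ℂ) * p.2) ''
      (Set.Icc (0 : ℝ) 1 ×ˢ Metric.closedBall w r)) :=
    (isCompact_Icc.prod (isCompact_closedBall w r)).image (by fun_prop)
  have hKU : ((fun p : ℝ × ℂ => (p.1 : ℂ) * p.2) ''
      (Set.Icc (0 : ℝ) 1 ×ˢ Metric.closedBall w r)) ⊆ U := by
    rintro _ ⟨⟨t, v⟩, ⟨ht, hv⟩, rfl⟩
    exact hst v (hrU hv) t ht
  obtain ⟨C, hC⟩ := hK.exists_bound_of_continuousOn (hd.mono hKU)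
  have hsub : ∀ {g : ℝ → ℂ}, ContinuousOn g (Set.Ioc 0 1) →
      MeasureTheory.AEStronglyMeasurable g
        (MeasureTheory.volume.restrict (Set.uIoc (0 : ℝ) 1)) := by
    intro g hg
    rw [Set.uIoc_of_le zero_le_one]
    exact hg.aestronglyMeasurable measurableSet_Ioc
  refine (intervalIntegral.hasDerivAt_integral_of_dominated_loc_of_deriv_le
    (F := fun (v : ℂ) (t : ℝ) => f (t * v) / t)
    (F' := fun (v : ℂ) (t : ℝ) => deriv f (t * v)) (bound := fun _ => C) (Metric.ball_mem_nhds w hr) ?_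
    (intervalIntegrable_ray hU hst hf h0 hw) ?_ ?_ ?_ ?_).2
  · filter_upwards [Metric.ball_mem_nhds w hr] with v hv
    apply hsub
    have := intervalIntegrable_ray hU hst hf h0 (hrU (Metric.ball_subset_closedBall hv))
    refine ContinuousOn.div ?_ (by fun_prop) ?_
    · refine hf.continuousOn.comp (by fun_prop) ?_
      intro t ht
      exact hst v (hrU (Metric.ball_subset_closedBall hv)) t ⟨ht.1.le, ht.2⟩
    · intro t ht
      exact_mod_cast ht.1.ne'
  · apply hsub
    refine hd.comp (by fun_prop) ?_
    intro t ht
    exact hst w hw t ⟨ht.1.le, ht.2⟩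
  · refine Filter.Eventually.of_forall fun t ht v hv => ?_
    rw [Set.uIoc_of_le zero_le_one] at ht
    exact hC _ ⟨(t, v), ⟨⟨ht.1.le, ht.2⟩, Metric.ball_subset_closedBall hv⟩, rfl⟩
  · simp
  · refine Filter.Eventually.of_forall fun t ht v hv => ?_
    rw [Set.uIoc_of_le zero_le_one] at ht
    have ht' : (t : ℂ) ≠ 0 := by exact_mod_cast ht.1.ne'
    have h1 : HasDerivAt f (deriv f (t * v)) (t * v) :=
      (hf.differentiableAt (hU.mem_nhds (hst v (hrU (Metric.ball_subset_closedBall hv)) t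
        ⟨ht.1.le, ht.2⟩))).hasDerivAt
    have h2 : HasDerivAt (fun v : ℂ => (t : ℂ) * v) (t * 1) v := (hasDerivAt_id v).const_mul _
    have h3 := (h1.comp v h2).div_const (t : ℂ)
    rw [mul_one, mul_div_assoc, div_self ht', mul_one] at h3
    exact h3

include hU hst hf h0 in
theorem mul_integral_deriv_ray {w : ℂ} (hw : w ∈ U) :
    w * ∫ t in (0 : ℝ)..1, deriv f (t * w) = f w := by
  have hd : ContinuousOn (deriv f) U := (hf.deriv hU).continuousOn
  have hcont : ContinuousOn (fun t : ℝ => deriv f (t * w) * w) (Set.uIcc 0 1) := by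
    rw [Set.uIcc_of_le zero_le_one]
    exact (hd.comp (by fun_prop) fun t ht => hst w hw t ht).mul continuousOn_const
  have h := intervalIntegral.integral_eq_sub_of_hasDerivAt (a := 0) (b := 1)
    (f := fun t : ℝ => f (t * w)) (f' := fun t : ℝ => deriv f (t * w) * w) ?_
    hcont.intervalIntegrable
  · rw [intervalIntegral.integral_mul_const] at h
    simpa [h0, mul_comm] using h
  · intro t ht
    rw [Set.uIcc_of_le zero_le_one] at ht
    have h1 : HasDerivAt f (deriv f (t * w)) (t * w) :=
      (hf.differentiableAt (hU.mem_nhds (hst w hw t ht))).hasDerivAt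
    have h2 : HasDerivAt (fun t : ℝ => (t : ℂ) * w) (1 * w) t :=
      (Complex.ofRealCLM.hasDerivAt (x := t)).mul_const w
    have h3 := h1.comp t h2
    rw [one_mul] at h3
    exact h3

end ray

/-! ### The dilogarithm and the trilogarithm on the slit plane -/

/-- The complex plane cut along `[1, ∞)`. -/
def cutPlane : Set ℂ := {w | 1 - w ∈ Complex.slitPlane}

theorem isOpen_cutPlane : IsOpen cutPlane :=
  Complex.isOpen_slitPlane.preimage (by fun_prop)

theorem mem_cutPlane {w : ℂ} : w ∈ cutPlane ↔ w.re < 1 ∨ w.im ≠ 0 := by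
  simp [cutPlane, Complex.mem_slitPlane_iff]

theorem mul_mem_cutPlane (w : ℂ) (hw : w ∈ cutPlane) (t : ℝ) (ht : t ∈ Set.Icc (0 : ℝ) 1) :
    (t : ℂ) * w ∈ cutPlane := by
  have h := Complex.starConvex_one_slitPlane hw (a := 1 - t) (b := t) (by linarith [ht.2]) ht.1
    (by ring)
  simp only [cutPlane, Set.mem_ofPred_eq]
  convert h using 1
  simp only [Complex.real_smul]
  push_cast
  ring

theorem ne_one_of_mem_cutPlane {w : ℂ} (hw : w ∈ cutPlane) : w ≠ 1 := by
  rintro rfl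
  simp [cutPlane] at hw

theorem differentiableOn_log_one_sub :
    DifferentiableOn ℂ (fun w => -Complex.log (1 - w)) cutPlane := by
  intro w hw
  exact ((differentiableAt_const _).sub differentiableAt_id).clog hw |>.neg.differentiableWithinAt

theorem Li2_eq (w : ℂ) : Li2 w = ∫ t in (0 : ℝ)..1, (fun w => -Complex.log (1 - w)) (t * w) / t := by
  simp only [Li2, neg_div, intervalIntegral.integral_neg]

theorem differentiableOn_Li2 : DifferentiableOn ℂ Li2 cutPlane := by
  intro w hw
  have h := hasDerivAt_integral_ray isOpen_cutPlane mul_mem_cutPlane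
    differentiableOn_log_one_sub (by simp) hw
  rw [← funext Li2_eq] at h
  exact h.differentiableAt.differentiableWithinAt

theorem hasDerivAt_Li2 {w : ℂ} (hw : w ∈ cutPlane) (hw0 : w ≠ 0) :
    HasDerivAt Li2 (-Complex.log (1 - w) / w) w := by
  have h := hasDerivAt_integral_ray isOpen_cutPlane mul_mem_cutPlane
    differentiableOn_log_one_sub (by simp) hw
  rw [← funext Li2_eq] at h
  convert h using 1
  rw [div_eq_iff hw0, mul_comm]
  exact (mul_integral_deriv_ray isOpen_cutPlane mul_mem_cutPlane
    differentiableOn_log_one_sub (by simp) hw).symm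

@[simp] theorem Li2_zero : Li2 0 = 0 := by simp [Li2]

theorem hasDerivAt_Li3 {w : ℂ} (hw : w ∈ cutPlane) (hw0 : w ≠ 0) :
    HasDerivAt Li3 (Li2 w / w) w := by
  have h := hasDerivAt_integral_ray isOpen_cutPlane mul_mem_cutPlane
    differentiableOn_Li2 (by simp) hw
  change HasDerivAt Li3 _ _ at h
  convert h using 1
  rw [div_eq_iff hw0, mul_comm]
  exact (mul_integral_deriv_ray isOpen_cutPlane mul_mem_cutPlane
    differentiableOn_Li2 (by simp) hw).symm

theorem Li2_ofReal_im {r : ℝ} (hr : r ≤ 1) : (Li2 r).im = 0 := by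
  have : Li2 r = ((-∫ t in (0 : ℝ)..1, Real.log (1 - t * r) / t : ℝ) : ℂ) := by
    rw [Li2, Complex.ofReal_neg, ← intervalIntegral.integral_ofReal]
    congr 1
    refine intervalIntegral.integral_congr fun t ht => ?_
    rw [Set.uIcc_of_le zero_le_one] at ht
    have : 0 ≤ 1 - t * r := by nlinarith [ht.1, ht.2]
    rw [Complex.ofReal_div, Complex.ofReal_log this]
    push_cast
    rfl
  rw [this, Complex.ofReal_im]

/-! ### Derivatives along curves -/

section curves

variable {f : ℝ → ℂ} {f' : ℂ} {s : ℝ}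

theorem hasDerivAt_re_comp (hf : HasDerivAt f f' s) : HasDerivAt (fun s => (f s).re) f'.re s :=
  Complex.reCLM.hasFDerivAt.comp_hasDerivAt s hf

theorem hasDerivAt_im_comp (hf : HasDerivAt f f' s) : HasDerivAt (fun s => (f s).im) f'.im s :=
  Complex.imCLM.hasFDerivAt.comp_hasDerivAt s hf

theorem hasDerivAt_log_norm (hf : HasDerivAt f f' s) (h0 : f s ≠ 0) :
    HasDerivAt (fun s => Real.log ‖f s‖) (f' / f s).re s := by
  -- Dividing by the constant f s moves the base point to 1, away from the cut of the logarithm, and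
  -- changes log‖f‖ only by a constant.
  have h1 : HasDerivAt (fun u => f u / f s) (f' / f s) s := hf.div_const _
  have h2 := hasDerivAt_re_comp (h1.clog_real (by simp [div_self h0]))
  rw [div_self h0, div_one] at h2
  refine (h2.const_add (Real.log ‖f s‖)).congr_of_eventuallyEq ?_
  filter_upwards [hf.continuousAt.eventually_ne h0] with u hu
  rw [Complex.log_re, norm_div, Real.log_div (norm_ne_zero_iff.2 hu) (norm_ne_zero_iff.2 h0)]
  ring

theorem hasDerivAt_comp_curve {g : ℂ → ℂ} {g' : ℂ} (hg : HasDerivAt g g' (f s))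
    (hf : HasDerivAt f f' s) : HasDerivAt (fun s => g (f s)) (g' * f') s :=
  hg.comp s hf

end curves

theorem constant_of_hasDerivAt_zero {h : ℝ → ℝ} {a b : ℝ} (hab : a ≤ b)
    (H : ∀ s ∈ Set.Icc a b, HasDerivAt h 0 s) : h b = h a :=
  constant_of_has_deriv_right_zero (fun s hs => (H s hs).continuousAt.continuousWithinAt)
    (fun s hs => (H s ⟨hs.1, hs.2.le⟩).hasDerivWithinAt) b ⟨hab, le_rfl⟩

/-- Integrating along radii makes h locally constant, hence Fréchet differentiable with derivative
zero. Functional equations on plane domains thus reduce to derivatives along real lines. -/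
theorem eq_of_hasDerivAt_lines_zero {U : Set ℂ} (hU : IsOpen U) (hc : IsPreconnected U)
    {h : ℂ → ℝ}
    (H : ∀ w v : ℂ, ∀ s : ℝ, w + s * v ∈ U → HasDerivAt (fun s : ℝ => h (w + s * v)) 0 s)
    {a b : ℂ} (ha : a ∈ U) (hb : b ∈ U) : h a = h b := by
  have key : ∀ w ∈ U, HasFDerivAt h (0 : ℂ →L[ℝ] ℝ) w := by
    intro w hw
    obtain ⟨r, hr, hrU⟩ := Metric.isOpen_iff.1 hU w hw
    refine (hasFDerivAt_const (h w) w).congr_of_eventuallyEq ?_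
    filter_upwards [Metric.ball_mem_nhds w hr] with v hv
    have := constant_of_hasDerivAt_zero (h := fun s : ℝ => h (w + s * (v - w))) zero_le_one
      (fun s hs => H w (v - w) s (hrU ?_))
    · simpa using this
    · rw [mem_ball_iff_norm] at hv ⊢
      rw [add_sub_cancel_left, norm_mul, Complex.norm_real, Real.norm_of_nonneg hs.1]
      nlinarith [hs.2, norm_nonneg (v - w)]
  exact hU.is_const_of_fderiv_eq_zero hc (fun w hw => (key w hw).differentiableAt.differentiableWithinAt)
    (fun w hw => (key w hw).fderiv) ha hb

theorem isPreconnected_compl_of_finite {S : Set ℂ} (hS : S.Finite) : IsPreconnected Sᶜ :=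
  (hS.countable.isPathConnected_compl_of_one_lt_rank
    (by rw [Complex.rank_real_complex]; norm_num)).isConnected.isPreconnected

theorem hasDerivAt_line (w v : ℂ) (s : ℝ) : HasDerivAt (fun s : ℝ => w + s * v) v s := by
  simpa using ((Complex.ofRealCLM.hasDerivAt (x := s)).mul_const v).const_add w

/-! ### The Bloch–Wigner dilogarithm -/

open Classical in
/-- The Bloch–Wigner dilogarithm. -/
noncomputable def blochWigner (w : ℂ) : ℝ :=
  if w ∈ cutPlane then (Li2 w).im + (1 - w).arg * Real.log ‖w‖ else 0

theorem blochWigner_of_mem {w : ℂ} (hw : w ∈ cutPlane) :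
    blochWigner w = (Li2 w).im + (1 - w).arg * Real.log ‖w‖ := if_pos hw

/-- The derivative of the Bloch–Wigner dilogarithm along a curve with velocity `f'` at `w`. -/
noncomputable def dBlochWigner (w f' : ℂ) : ℝ :=
  Real.log ‖w‖ * (-f' / (1 - w)).im - Real.log ‖1 - w‖ * (f' / w).im

/-- Left of 1 both Im Li₂ and the argument of 1 - r vanish; on the cut the value is 0 by definition.
-/
theorem blochWigner_ofReal (r : ℝ) : blochWigner r = 0 := by
  by_cases h : (r : ℂ) ∈ cutPlane
  · have hr : r < 1 := by simpa [mem_cutPlane] using h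
    rw [blochWigner_of_mem h, Li2_ofReal_im hr.le]
    have : (1 - (r : ℂ)).arg = 0 := by
      rw [← Complex.ofReal_one, ← Complex.ofReal_sub, Complex.arg_ofReal_of_nonneg (by linarith)]
    simp [this]
  · exact if_neg h

@[simp] theorem blochWigner_zero : blochWigner 0 = 0 := by simpa using blochWigner_ofReal 0

@[simp] theorem blochWigner_one : blochWigner 1 = 0 := by simpa using blochWigner_ofReal 1

theorem eventually_mem_cutPlane {f : ℝ → ℂ} {s : ℝ} (hf : ContinuousAt f s)
    (h : f s ∈ cutPlane) : ∀ᶠ u in nhds s, f u ∈ cutPlane :=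
  hf.eventually_mem (isOpen_cutPlane.mem_nhds h)

theorem hasDerivAt_blochWigner_of_mem {f : ℝ → ℂ} {f' : ℂ} {s : ℝ} (hf : HasDerivAt f f' s)
    (hc : f s ∈ cutPlane) (h0 : f s ≠ 0) :
    HasDerivAt (fun s => blochWigner (f s)) (dBlochWigner (f s) f') s := by
  have h1 := hasDerivAt_im_comp (hasDerivAt_comp_curve (hasDerivAt_Li2 hc h0) hf)
  have h2 := hasDerivAt_im_comp ((hf.const_sub 1).clog_real hc)
  have h3 := hasDerivAt_log_norm hf h0
  refine ((h1.add (h2.mul h3)).congr_of_eventuallyEq ?_).congr_deriv ?_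
  · filter_upwards [eventually_mem_cutPlane hf.continuousAt hc] with u hu
    rw [blochWigner_of_mem hu]
    simp [Complex.log_im]
  · have : -Complex.log (1 - f s) / f s * f' = -(Complex.log (1 - f s) * (f' / f s)) := by
      ring
    rw [this, Complex.neg_im, Complex.mul_im, Complex.log_re, Complex.log_im, dBlochWigner]
    ring

/-- The complex plane cut along `[0, ∞)`. -/
def posCutPlane : Set ℂ := {w | -w ∈ Complex.slitPlane}

theorem isOpen_posCutPlane : IsOpen posCutPlane :=
  Complex.isOpen_slitPlane.preimage continuous_neg

theorem mem_posCutPlane {w : ℂ} : w ∈ posCutPlane ↔ w.re < 0 ∨ w.im ≠ 0 := by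
  simp [posCutPlane, Complex.mem_slitPlane_iff]

theorem isPreconnected_posCutPlane : IsPreconnected posCutPlane := by
  have h : IsPreconnected ((fun w : ℂ => -w) '' Complex.slitPlane) :=
    (Complex.starConvex_one_slitPlane.isPathConnected (by simp)).isConnected.isPreconnected.image _
      continuous_neg.continuousOn
  have : posCutPlane = (fun w : ℂ => -w) '' Complex.slitPlane := by
    ext w
    simp [posCutPlane]
  rwa [this]

theorem neg_one_mem_posCutPlane : (-1 : ℂ) ∈ posCutPlane := by simp [mem_posCutPlane]

theorem posCutPlane_subset : posCutPlane ⊆ cutPlane := by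
  intro w hw
  rw [mem_posCutPlane] at hw
  rw [mem_cutPlane]
  exact hw.imp_left fun h => by linarith

theorem ne_zero_of_mem_posCutPlane {w : ℂ} (hw : w ∈ posCutPlane) : w ≠ 0 := by
  rintro rfl
  simp [mem_posCutPlane] at hw

theorem inv_mem_posCutPlane {w : ℂ} (hw : w ∈ posCutPlane) : w⁻¹ ∈ posCutPlane := by
  have h0 := Complex.normSq_pos.2 (ne_zero_of_mem_posCutPlane hw)
  rw [mem_posCutPlane] at hw ⊢
  rw [Complex.inv_re, Complex.inv_im]
  exact hw.imp (fun h => div_neg_of_neg_of_pos h h0)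
    (fun h => div_ne_zero (neg_ne_zero.2 h) h0.ne')

theorem eq_ofReal_of_notMem_posCutPlane {w : ℂ} (hw : w ∉ posCutPlane) :
    ∃ r : ℝ, 0 ≤ r ∧ w = r := by
  rw [mem_posCutPlane] at hw
  push Not at hw
  exact ⟨w.re, hw.1, Complex.ext rfl (by simpa using hw.2)⟩

theorem dBlochWigner_inv {w f' : ℂ} (h0 : w ≠ 0) (h1 : w ≠ 1) :
    dBlochWigner w⁻¹ (-f' / w ^ 2) = -dBlochWigner w f' := by
  have h1' : 1 - w ≠ 0 := sub_ne_zero.2 h1.symm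
  have h2 : w - 1 ≠ 0 := sub_ne_zero.2 h1
  have e1 : 1 - w⁻¹ = -((1 - w) / w) := by field_simp; ring
  have e2 : -(-f' / w ^ 2) / (1 - w⁻¹) = -f' / (1 - w) - f' / w := by
    rw [e1]; field_simp; ring
  have e3 : -f' / w ^ 2 / w⁻¹ = -(f' / w) := by field_simp
  rw [dBlochWigner, dBlochWigner, e2, e3, e1, norm_neg, norm_div, norm_inv, Real.log_inv,
    Real.log_div (norm_ne_zero_iff.2 h1') (norm_ne_zero_iff.2 h0), Complex.neg_im, Complex.sub_im]
  ring

/-- The differentials of the two sides agree on the connected plane cut along [0,∞), which inversion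
preserves; the fixed point -1, where D vanishes, fixes the constant. On [0,∞) both sides are zero.
-/
theorem blochWigner_inv (w : ℂ) : blochWigner w⁻¹ = -blochWigner w := by
  by_cases hw : w ∈ posCutPlane
  · have := eq_of_hasDerivAt_lines_zero isOpen_posCutPlane isPreconnected_posCutPlane
      (h := fun w => blochWigner w⁻¹ + blochWigner w) ?_ hw neg_one_mem_posCutPlane
    · have h1 : blochWigner (-1) = 0 := by simpa using blochWigner_ofReal (-1)
      have h2 : (-1 : ℂ)⁻¹ = -1 := by norm_num
      simp only [h2, h1] at this
      linarith
    · intro w v s hs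
      have hl := hasDerivAt_line w v s
      have h0 := ne_zero_of_mem_posCutPlane hs
      have hi := inv_mem_posCutPlane hs
      refine ((hasDerivAt_blochWigner_of_mem (hl.inv h0) (posCutPlane_subset hi)
        (inv_ne_zero h0)).add
        (hasDerivAt_blochWigner_of_mem hl (posCutPlane_subset hs) h0)).congr_deriv ?_
      simp only [Pi.inv_apply]
      rw [dBlochWigner_inv h0 (ne_one_of_mem_cutPlane (posCutPlane_subset hs))]
      ring
  · obtain ⟨r, -, rfl⟩ := eq_ofReal_of_notMem_posCutPlane hw
    rw [← Complex.ofReal_inv, blochWigner_ofReal, blochWigner_ofReal, neg_zero]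

theorem inv_mem_cutPlane_of_notMem {w : ℂ} (h : w ∉ cutPlane) (h1 : w ≠ 1) :
    w⁻¹ ∈ cutPlane := by
  rw [mem_cutPlane] at h
  push Not at h
  obtain ⟨r, hr⟩ : ∃ r : ℝ, w = r := ⟨w.re, Complex.ext rfl (by simpa using h.2)⟩
  subst hr
  have hr1 : r ≠ 1 := by simpa using h1
  have hr2 : 1 < r := lt_of_le_of_ne (by simpa using h.1) hr1.symm
  rw [mem_cutPlane, ← Complex.ofReal_inv]
  left
  simpa using inv_lt_one_of_one_lt₀ hr2

/-- A point of (1,∞) is moved by inversion to (0,1), off the cut, and D and its differential both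
change sign. -/
theorem hasDerivAt_blochWigner {f : ℝ → ℂ} {f' : ℂ} {s : ℝ} (hf : HasDerivAt f f' s)
    (h0 : f s ≠ 0) (h1 : f s ≠ 1) :
    HasDerivAt (fun s => blochWigner (f s)) (dBlochWigner (f s) f') s := by
  by_cases hc : f s ∈ cutPlane
  · exact hasDerivAt_blochWigner_of_mem hf hc h0
  · have := (hasDerivAt_blochWigner_of_mem (hf.inv h0) (inv_mem_cutPlane_of_notMem hc h1)
      (inv_ne_zero h0)).neg
    simp only [Pi.inv_apply] at this
    rw [dBlochWigner_inv h0 h1, neg_neg] at this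
    refine this.congr_of_eventuallyEq (Filter.Eventually.of_forall fun u => ?_)
    simp [blochWigner_inv]

/-- The sum of D(1 - w) and D(w) has zero differential off {0, 1}; the constant is read off at the
real fixed point 1/2. -/
theorem blochWigner_one_sub (w : ℂ) : blochWigner (1 - w) = -blochWigner w := by
  rcases eq_or_ne w 0 with rfl | h0
  · simp
  rcases eq_or_ne w 1 with rfl | h1
  · simp
  have hS : ({0, 1} : Set ℂ).Finite := by simp
  have := eq_of_hasDerivAt_lines_zero hS.isClosed.isOpen_compl
    (isPreconnected_compl_of_finite hS)
    (h := fun w => blochWigner (1 - w) + blochWigner w) (a := w) (b := 1 / 2) ?_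
    (by simp [h0, h1]) (by norm_num)
  · have h2 : blochWigner (1 / 2) = 0 := by simpa using blochWigner_ofReal (1 / 2)
    have h3 : (1 - 1 / 2 : ℂ) = 1 / 2 := by norm_num
    simp only [h3, h2] at this
    linarith
  · intro w v s hs
    have hl := hasDerivAt_line w v s
    simp only [Set.mem_compl_iff, Set.mem_insert_iff, Set.mem_singleton_iff, not_or] at hs
    have h2 : 1 - (w + s * v) ≠ 0 := sub_ne_zero.2 (Ne.symm hs.2)
    refine ((hasDerivAt_blochWigner (hl.const_sub 1) h2 (by simpa using hs.1)).add
      (hasDerivAt_blochWigner hl hs.1 hs.2)).congr_deriv ?_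
    simp only [dBlochWigner, sub_sub_cancel, neg_neg]
    ring

/-- The only doubtful term is arg(1-w) log|w|, and arg(1-w) = O(|w|) while |w| log|w| tends to 0. -/
theorem continuousAt_blochWigner_zero : ContinuousAt blochWigner 0 := by
  have h0 : (0 : ℂ) ∈ cutPlane := by simp [mem_cutPlane]
  have hev : (fun w => (Li2 w).im + (1 - w).arg * Real.log ‖w‖) =ᶠ[nhds 0] blochWigner := by
    filter_upwards [isOpen_cutPlane.mem_nhds h0] with w hw
    rw [blochWigner_of_mem hw]
  rw [ContinuousAt, blochWigner_zero]
  refine Filter.Tendsto.congr' hev ?_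
  have h1 : Filter.Tendsto (fun w => (Li2 w).im) (nhds 0) (nhds 0) := by
    have := (differentiableOn_Li2.differentiableAt (isOpen_cutPlane.mem_nhds h0)).continuousAt
    have h := (Complex.continuous_im.continuousAt.comp this).tendsto
    simp only [Function.comp_apply, Li2_zero, Complex.zero_im] at h
    exact h
  have h2 : Filter.Tendsto (fun w : ℂ => (1 - w).arg * Real.log ‖w‖) (nhds 0) (nhds 0) := by
    have hd := (differentiableOn_log_one_sub.differentiableAt
      (isOpen_cutPlane.mem_nhds h0)).isBigO_sub
    have hd' : (fun w : ℂ => Complex.log (1 - w)) =O[nhds 0] (fun w : ℂ => ‖w‖) := by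
      simpa using hd.norm_right
    have hb : (fun w : ℂ => (1 - w).arg) =O[nhds 0] (fun w : ℂ => ‖w‖) := by
      refine Asymptotics.IsBigO.trans (g := fun w : ℂ => ‖Complex.log (1 - w)‖)
        (Asymptotics.IsBigO.of_norm_le fun w => ?_) hd'.norm_left
      rw [← Complex.log_im]
      exact Complex.abs_im_le_norm _
    refine (hb.mul (Asymptotics.isBigO_refl (fun w : ℂ => Real.log ‖w‖) _)).trans_tendsto ?_
    have := (Real.continuous_mul_log.tendsto 0).comp (tendsto_norm_zero (E := ℂ))
    simpa [Function.comp_def] using this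
  simpa using h1.add h2

theorem continuousAt_blochWigner_one : ContinuousAt blochWigner 1 := by
  have h : blochWigner = fun w => -blochWigner (1 - w) := by
    funext w
    rw [blochWigner_one_sub, neg_neg]
  rw [h]
  refine ContinuousAt.neg (ContinuousAt.comp (g := blochWigner) (f := fun w : ℂ => 1 - w) ?_ (by fun_prop))
  simpa using continuousAt_blochWigner_zero

theorem continuousAt_blochWigner_of_mem {w : ℂ} (hw : w ∈ cutPlane) (h0 : w ≠ 0) :
    ContinuousAt blochWigner w := by
  have h1 : ContinuousAt (fun w => (Li2 w).im) w :=
    Complex.continuous_im.continuousAt.comp (hasDerivAt_Li2 hw h0).continuousAt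
  have h2 : ContinuousAt (fun w : ℂ => (1 - w).arg) w :=
    ContinuousAt.comp (g := Complex.arg) (f := fun w : ℂ => 1 - w) (Complex.continuousAt_arg hw)
      (by fun_prop)
  have h3 : ContinuousAt (fun w : ℂ => Real.log ‖w‖) w :=
    ContinuousAt.log (by fun_prop) (norm_ne_zero_iff.2 h0)
  refine (h1.add (h2.mul h3)).congr ?_
  filter_upwards [isOpen_cutPlane.mem_nhds hw] with v hv using (blochWigner_of_mem hv).symm

theorem continuous_blochWigner : Continuous blochWigner := by
  rw [continuous_iff_continuousAt]
  intro w
  rcases eq_or_ne w 0 with rfl | h0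
  · exact continuousAt_blochWigner_zero
  rcases eq_or_ne w 1 with rfl | h1
  · exact continuousAt_blochWigner_one
  by_cases hw : w ∈ cutPlane
  · exact continuousAt_blochWigner_of_mem hw h0
  · have h : blochWigner = fun w => -blochWigner w⁻¹ := by
      funext v
      rw [blochWigner_inv, neg_neg]
    rw [h]
    exact (ContinuousAt.comp (g := blochWigner) (f := fun w : ℂ => w⁻¹)
      (continuousAt_blochWigner_of_mem (inv_mem_cutPlane_of_notMem hw h1) (inv_ne_zero h0))
      (continuousAt_inv₀ h0)).neg

/-! ### The polylogarithms on the positive real axis -/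

/-- The measure dt/t is invariant under scaling. As integrals over [0, r], `Li2` and `Li3` can be
differentiated in the real variable r > 1, on the cut, where the complex derivative formulas are
unavailable. -/
theorem integral_ray_ofReal (g : ℂ → ℂ) {r : ℝ} (hr : r ≠ 0) :
    ∫ t in (0 : ℝ)..1, g (t * r) / t = ∫ s in (0 : ℝ)..r, g s / s := by
  have h := intervalIntegral.integral_comp_mul_right (a := 0) (b := 1)
    (fun s : ℝ => g s / s) hr
  rw [zero_mul, one_mul] at h
  have hr' : (r : ℂ) ≠ 0 := by exact_mod_cast hr
  have h2 : ∫ s in (0 : ℝ)..r, g s / s = r • ∫ t in (0 : ℝ)..1, g ((t * r : ℝ)) / ((t * r : ℝ) : ℂ) := by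
    rw [h, smul_smul, mul_inv_cancel₀ hr, one_smul]
  rw [h2, ← intervalIntegral.integral_smul]
  refine intervalIntegral.integral_congr fun t _ => ?_
  simp only [Complex.real_smul, Complex.ofReal_mul]
  rw [mul_comm (t : ℂ) r, ← mul_div_assoc, mul_div_mul_left _ _ hr']

theorem intervalIntegrable_div_self {f : ℂ → ℂ} {U : Set ℂ} (hU : IsOpen U)
    (hf : DifferentiableOn ℂ f U) (h0 : f 0 = 0) {a : ℝ} (ha : 0 ≤ a)
    (hst : ∀ t ∈ Set.Icc 0 a, (t : ℂ) ∈ U) :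
    IntervalIntegrable (fun t : ℝ => f t / t) MeasureTheory.volume 0 a := by
  have h0U : (0 : ℂ) ∈ U := by simpa using hst 0 ⟨le_rfl, ha⟩
  have h1 : ContinuousOn (dslope f 0) U :=
    (continuousOn_dslope (hU.mem_nhds h0U)).2
      ⟨hf.continuousOn, hf.differentiableAt (hU.mem_nhds h0U)⟩
  have h2 : ContinuousOn (fun t : ℝ => dslope f 0 t) (Set.uIcc 0 a) := by
    rw [Set.uIcc_of_le ha]
    exact h1.comp (by fun_prop) hst
  refine h2.intervalIntegrable.congr fun t ht => ?_
  rw [Set.uIoc_of_le ha] at ht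
  simpa using (div_eq_mul_dslope h0 1 ht.1.ne').symm

theorem ofReal_mem_cutPlane {t : ℝ} (ht : t < 1) : (t : ℂ) ∈ cutPlane := by
  simpa [mem_cutPlane] using ht

theorem intervalIntegrable_log_one_sub (a b : ℝ) :
    IntervalIntegrable (fun s : ℝ => -Complex.log (1 - s)) MeasureTheory.volume a b := by
  have h1 : IntervalIntegrable (fun s : ℝ => Real.log (1 - s)) MeasureTheory.volume a b := by
    have := (intervalIntegral.intervalIntegrable_log' (a := 1 - a) (b := 1 - b)).comp_sub_left 1
    simpa using this
  have h2 : IntervalIntegrable (fun s : ℝ => (1 - (s : ℂ)).arg) MeasureTheory.volume a b := by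
    refine (intervalIntegrable_const (c := Real.pi)).mono_fun
      (by fun_prop : Measurable fun s : ℝ => (1 - (s : ℂ)).arg).aestronglyMeasurable
      (Filter.Eventually.of_forall fun s => ?_)
    simpa [abs_of_pos Real.pi_pos] using Complex.abs_arg_le_pi _
  have hof : ∀ {g : ℝ → ℝ}, IntervalIntegrable g MeasureTheory.volume a b →
      IntervalIntegrable (fun s => (g s : ℂ)) MeasureTheory.volume a b :=
    fun hg => ⟨hg.1.ofReal, hg.2.ofReal⟩
  have h3 := (hof h1).add ((hof h2).mul_const Complex.I)
  refine h3.neg.congr fun s _ => ?_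
  simp only [Pi.neg_apply, Complex.log]
  congr 3
  rw [← Complex.ofReal_one, ← Complex.ofReal_sub, Complex.norm_real, Real.norm_eq_abs, Real.log_abs]

theorem intervalIntegrable_log_one_sub_div {R : ℝ} (hR : 1 ≤ R) :
    IntervalIntegrable (fun s : ℝ => -Complex.log (1 - s) / s) MeasureTheory.volume 0 R := by
  refine (intervalIntegrable_div_self isOpen_cutPlane differentiableOn_log_one_sub (by simp)
    (a := 1 / 2) (by norm_num) fun t ht => ofReal_mem_cutPlane (by linarith [ht.2])).trans ?_
  simp only [div_eq_mul_inv]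
  refine (intervalIntegrable_log_one_sub _ R).mul_continuousOn ?_
  refine ContinuousOn.inv₀ (by fun_prop) fun s hs => ?_
  rw [Set.uIcc_of_le (by linarith)] at hs
  have : s ≠ 0 := by linarith [hs.1]
  exact_mod_cast this

theorem Li2_ofReal {r : ℝ} (hr : r ≠ 0) :
    Li2 r = ∫ s in (0 : ℝ)..r, -Complex.log (1 - s) / s := by
  rw [Li2_eq, integral_ray_ofReal (fun w => -Complex.log (1 - w)) hr]

theorem continuousAt_primitive {g : ℝ → ℂ} {R r : ℝ}
    (hg : IntervalIntegrable g MeasureTheory.volume 0 R) (hr : r ∈ Set.Ioo 0 R) :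
    ContinuousAt (fun r => ∫ s in (0 : ℝ)..r, g s) r := by
  refine (intervalIntegral.continuousOn_primitive_interval' hg (by simp)).continuousAt ?_
  rw [Set.uIcc_of_le (hr.1.trans hr.2).le]
  exact Icc_mem_nhds hr.1 hr.2

theorem continuousAt_Li2_ofReal {r : ℝ} (hr : 0 < r) : ContinuousAt (fun r : ℝ => Li2 r) r := by
  refine (continuousAt_primitive (intervalIntegrable_log_one_sub_div (R := r + 1) (by linarith))
    ⟨hr, by linarith⟩).congr ?_
  filter_upwards [lt_mem_nhds hr] with u hu using (Li2_ofReal hu.ne').symm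

/-- For real s > 1 the principal argument of 1 - s is constantly π, so the restriction to the real
axis is continuous although the complex function jumps there. -/
theorem continuousAt_log_one_sub_ofReal {r : ℝ} (hr : 1 < r) :
    ContinuousAt (fun s : ℝ => Complex.log (1 - s)) r := by
  have h : ContinuousAt (fun s : ℝ => ((Real.log (1 - s) : ℝ) : ℂ) + Real.pi * Complex.I) r := by
    refine ContinuousAt.add (Complex.continuous_ofReal.continuousAt.comp
      (ContinuousAt.log (by fun_prop) (by linarith))) continuousAt_const
  refine h.congr ?_
  filter_upwards [lt_mem_nhds hr] with s hs
  rw [← Complex.ofReal_one, ← Complex.ofReal_sub, Complex.log,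
    Complex.arg_ofReal_of_neg (by linarith), Complex.norm_real, Real.norm_eq_abs, Real.log_abs]

theorem hasDerivAt_Li2_ofReal {r : ℝ} (hr : 1 < r) :
    HasDerivAt (fun r : ℝ => Li2 r) (-Complex.log (1 - r) / r) r := by
  have h0 : (r : ℂ) ≠ 0 := by exact_mod_cast (by linarith : r ≠ 0)
  have hm : Measurable fun s : ℝ => -Complex.log (1 - s) / s := by fun_prop
  refine (intervalIntegral.integral_hasDerivAt_right
    (intervalIntegrable_log_one_sub_div hr.le)
    hm.stronglyMeasurable.stronglyMeasurableAtFilter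
    ((continuousAt_log_one_sub_ofReal hr).neg.div (by fun_prop) h0)).congr_of_eventuallyEq ?_
  filter_upwards [lt_mem_nhds hr] with u hu using Li2_ofReal (by linarith)

theorem intervalIntegrable_Li2_div {R : ℝ} (hR : 1 ≤ R) :
    IntervalIntegrable (fun s : ℝ => Li2 s / s) MeasureTheory.volume 0 R := by
  refine (intervalIntegrable_div_self isOpen_cutPlane differentiableOn_Li2 (by simp)
    (a := 1 / 2) (by norm_num) fun t ht => ofReal_mem_cutPlane (by linarith [ht.2])).trans ?_
  refine ContinuousOn.intervalIntegrable fun s hs => ContinuousAt.continuousWithinAt ?_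
  rw [Set.uIcc_of_le (by linarith)] at hs
  have h0 : 0 < s := by linarith [hs.1]
  exact (continuousAt_Li2_ofReal h0).div (by fun_prop) (by exact_mod_cast h0.ne')

theorem Li3_ofReal {r : ℝ} (hr : r ≠ 0) : Li3 r = ∫ s in (0 : ℝ)..r, Li2 s / s := by
  rw [Li3, integral_ray_ofReal Li2 hr]

theorem continuousAt_Li3_ofReal {r : ℝ} (hr : 0 < r) : ContinuousAt (fun r : ℝ => Li3 r) r := by
  refine (continuousAt_primitive (intervalIntegrable_Li2_div (R := r + 1) (by linarith))
    ⟨hr, by linarith⟩).congr ?_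
  filter_upwards [lt_mem_nhds hr] with u hu using (Li3_ofReal hu.ne').symm

theorem hasDerivAt_Li3_ofReal {r : ℝ} (hr : 1 < r) :
    HasDerivAt (fun r : ℝ => Li3 r) (Li2 r / r) r := by
  have h0 : (r : ℂ) ≠ 0 := by exact_mod_cast (by linarith : r ≠ 0)
  have hc : ∀ u : ℝ, 1 < u → ContinuousAt (fun s : ℝ => Li2 s / s) u := fun u hu =>
    (continuousAt_Li2_ofReal (by linarith)).div (by fun_prop)
      (by exact_mod_cast (by linarith : u ≠ 0))
  refine (intervalIntegral.integral_hasDerivAt_right (intervalIntegrable_Li2_div hr.le)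
    (ContinuousAt.stronglyMeasurableAtFilter isOpen_Ioi hc r hr)
    (hc r hr)).congr_of_eventuallyEq ?_
  filter_upwards [lt_mem_nhds hr] with u hu using Li3_ofReal (by linarith)

/-! ### The single-valued trilogarithm -/

/-- The derivative of the single-valued trilogarithm along a curve with velocity `f'` at `w`. -/
noncomputable def dSvLi3 (w f' : ℂ) : ℝ :=
  -blochWigner w * (f' / w).im +
    1 / 3 * Real.log ‖w‖ * (Real.log ‖1 - w‖ * (f' / w).re - Real.log ‖w‖ * (-f' / (1 - w)).re)

theorem dSvLi3_inv {w f' : ℂ} (h0 : w ≠ 0) (h1 : w ≠ 1) :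
    dSvLi3 w⁻¹ (-f' / w ^ 2) = dSvLi3 w f' := by
  have h1' : 1 - w ≠ 0 := sub_ne_zero.2 h1.symm
  have h2 : w - 1 ≠ 0 := sub_ne_zero.2 h1
  have e1 : 1 - w⁻¹ = -((1 - w) / w) := by field_simp; ring
  have e2 : -(-f' / w ^ 2) / (1 - w⁻¹) = -f' / (1 - w) - f' / w := by
    rw [e1]; field_simp; ring
  have e3 : -f' / w ^ 2 / w⁻¹ = -(f' / w) := by field_simp
  rw [dSvLi3, dSvLi3, e2, e3, e1, norm_neg, norm_div, norm_inv, Real.log_inv,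
    Real.log_div (norm_ne_zero_iff.2 h1') (norm_ne_zero_iff.2 h0), Complex.neg_im, Complex.neg_re,
    Complex.sub_re, blochWigner_inv]
  ring

theorem hasDerivAt_svLi3_of_mem {f : ℝ → ℂ} {f' : ℂ} {s : ℝ} (hf : HasDerivAt f f' s)
    (hc : f s ∈ cutPlane) (h0 : f s ≠ 0) :
    HasDerivAt (fun s => svLi3 (f s)) (dSvLi3 (f s) f') s := by
  have h1 := hasDerivAt_re_comp (hasDerivAt_comp_curve (hasDerivAt_Li3 hc h0) hf)
  have h2 := hasDerivAt_re_comp (hasDerivAt_comp_curve (hasDerivAt_Li2 hc h0) hf)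
  have h3 := hasDerivAt_log_norm hf h0
  have h4 := hasDerivAt_log_norm (hf.const_sub 1)
    (sub_ne_zero.2 (ne_one_of_mem_cutPlane hc).symm)
  refine ((h1.sub (h3.mul h2)).sub (((h3.pow 2).const_mul (1 / 3)).mul h4)).congr_deriv ?_
  have e1 : -Complex.log (1 - f s) / f s * f' = -(Complex.log (1 - f s) * (f' / f s)) := by
    ring
  have e2 : Li2 (f s) / f s * f' = Li2 (f s) * (f' / f s) := by ring
  rw [e1, e2, Complex.neg_re, Complex.mul_re, Complex.mul_re, Complex.log_re, Complex.log_im,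
    dSvLi3, blochWigner_of_mem hc]
  simp only [Pi.pow_apply]
  push_cast
  ring

theorem svLi3_inv_of_mem {w : ℂ} (hw : w ∈ posCutPlane) : svLi3 w⁻¹ = svLi3 w := by
  have := eq_of_hasDerivAt_lines_zero isOpen_posCutPlane isPreconnected_posCutPlane
    (h := fun w => svLi3 w⁻¹ - svLi3 w) ?_ hw neg_one_mem_posCutPlane
  · have h2 : (-1 : ℂ)⁻¹ = -1 := by norm_num
    simp only [h2] at this
    linarith
  · intro w v s hs
    have hl := hasDerivAt_line w v s
    have h0 := ne_zero_of_mem_posCutPlane hs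
    have hi := inv_mem_posCutPlane hs
    refine ((hasDerivAt_svLi3_of_mem (hl.inv h0) (posCutPlane_subset hi)
      (inv_ne_zero h0)).sub
      (hasDerivAt_svLi3_of_mem hl (posCutPlane_subset hs) h0)).congr_deriv ?_
    simp only [Pi.inv_apply]
    rw [dSvLi3_inv h0 (ne_one_of_mem_cutPlane (posCutPlane_subset hs))]
    ring

theorem hasDerivAt_svLi3_ofReal {r : ℝ} (hr : 1 < r) :
    HasDerivAt (fun r : ℝ => svLi3 r) (dSvLi3 r 1) r := by
  have h0 : (r : ℂ) ≠ 0 := by exact_mod_cast (by linarith : r ≠ 0)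
  have h10 : (1 - r : ℂ) ≠ 0 := by exact_mod_cast (by linarith : 1 - r ≠ 0)
  have hf : HasDerivAt (fun r : ℝ => (r : ℂ)) 1 r := Complex.ofRealCLM.hasDerivAt
  have h1 := hasDerivAt_re_comp (hasDerivAt_Li3_ofReal hr)
  have h2 := hasDerivAt_re_comp (hasDerivAt_Li2_ofReal hr)
  have h3 := hasDerivAt_log_norm hf h0
  have h4 := hasDerivAt_log_norm (hf.const_sub 1) h10
  refine ((h1.sub (h3.mul h2)).sub (((h3.pow 2).const_mul (1 / 3)).mul h4)).congr_deriv ?_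
  rw [dSvLi3, blochWigner_ofReal]
  have e1 : -Complex.log (1 - r) / r = -(Complex.log (1 - r) * (1 / r)) := by ring
  have e2 : Li2 r / r = Li2 r * (1 / r) := by ring
  have e3 : (1 / r : ℂ).im = 0 := by
    rw [← Complex.ofReal_one, ← Complex.ofReal_div, Complex.ofReal_im]
  rw [e1, e2, Complex.neg_re, Complex.mul_re, Complex.mul_re, Complex.log_re, e3]
  simp only [Pi.pow_apply]
  push_cast
  ring

/-- In the last term log|r| = O(|1-r|) enters squared against a single log|1-r|, so the limit is 0,
which is also the value at r = 1. -/
theorem continuousAt_svLi3_ofReal_one : ContinuousAt (fun r : ℝ => svLi3 r) 1 := by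
  have h1 := Complex.continuous_re.continuousAt.comp (continuousAt_Li3_ofReal one_pos)
  have h2 := Complex.continuous_re.continuousAt.comp (continuousAt_Li2_ofReal one_pos)
  have h3 : ContinuousAt (fun r : ℝ => Real.log ‖(r : ℂ)‖) 1 :=
    ContinuousAt.log (by fun_prop) (by simp)
  refine (h1.sub (h3.mul h2)).sub ?_
  rw [ContinuousAt]
  simp only [Complex.ofReal_one, norm_one, Real.log_one, sub_self, norm_zero, Real.log_zero]
  have hlog : (fun r : ℝ => Real.log ‖(r : ℂ)‖) =O[nhds 1] (fun r : ℝ => ‖1 - (r : ℂ)‖) := by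
    have := (Real.hasDerivAt_log one_ne_zero).differentiableAt.isBigO_sub
    simp only [Real.log_one, sub_zero] at this
    refine (this.congr' (Filter.Eventually.of_forall fun r => ?_) Filter.EventuallyEq.rfl).trans
      (Asymptotics.IsBigO.of_norm_le fun r => ?_)
    · simp [Real.log_abs]
    · rw [← Complex.ofReal_one, ← Complex.ofReal_sub, Complex.norm_real, norm_sub_rev]
  have hn : Filter.Tendsto (fun r : ℝ => ‖1 - (r : ℂ)‖) (nhds 1) (nhds 0) := by
    have : Continuous (fun r : ℝ => ‖1 - (r : ℂ)‖) := by fun_prop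
    simpa using this.tendsto 1
  have hmul : Filter.Tendsto (fun r : ℝ => ‖1 - (r : ℂ)‖ * (‖1 - (r : ℂ)‖ * Real.log ‖1 - (r : ℂ)‖))
      (nhds 1) (nhds 0) := by
    have := hn.mul ((Real.continuous_mul_log.tendsto 0).comp hn)
    simpa [Function.comp_def] using this
  have hO := ((hlog.mul (hlog.mul
    (Asymptotics.isBigO_refl (fun r : ℝ => Real.log ‖1 - (r : ℂ)‖) (nhds 1)))).const_mul_left
      (1 / 3)).trans_tendsto hmul
  simp only [mul_zero]
  refine hO.congr fun r => ?_
  ring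

/-- On (1,∞) the difference of the two sides has derivative zero and it extends continuously to 1, a
fixed point of inversion. The value of `svLi3` on the cut is a genuine integral, so this case needs
proof. -/
theorem svLi3_inv_ofReal {r : ℝ} (hr : 1 < r) : svLi3 (r : ℂ)⁻¹ = svLi3 r := by
  have hmem : ∀ u : ℝ, 1 < u → (u : ℂ)⁻¹ ∈ cutPlane := fun u hu => by
    rw [← Complex.ofReal_inv]
    exact ofReal_mem_cutPlane (inv_lt_one_of_one_lt₀ hu)
  have hd : ∀ u : ℝ, 1 < u → HasDerivAt (fun r : ℝ => svLi3 (r : ℂ)⁻¹ - svLi3 r) 0 u := by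
    intro u hu
    have h0 : (u : ℂ) ≠ 0 := by exact_mod_cast (by linarith : u ≠ 0)
    have h1 : (u : ℂ) ≠ 1 := by exact_mod_cast hu.ne'
    have hf : HasDerivAt (fun r : ℝ => (r : ℂ)) 1 u := Complex.ofRealCLM.hasDerivAt
    have h2 := (hasDerivAt_svLi3_of_mem (hf.inv h0) (hmem u hu) (inv_ne_zero h0)).sub
      (hasDerivAt_svLi3_ofReal hu)
    simp only [Pi.inv_apply] at h2
    rw [dSvLi3_inv h0 h1, sub_self] at h2
    exact h2
  have h1 : ContinuousAt (fun r : ℝ => svLi3 (r : ℂ)⁻¹ - svLi3 r) 1 := by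
    refine ContinuousAt.sub ?_ continuousAt_svLi3_ofReal_one
    have : ContinuousAt (fun r : ℝ => svLi3 ((r⁻¹ : ℝ) : ℂ)) 1 :=
      ContinuousAt.comp (g := fun r : ℝ => svLi3 r) (f := fun r : ℝ => r⁻¹)
        (by simpa using continuousAt_svLi3_ofReal_one) (continuousAt_inv₀ one_ne_zero)
    simpa using this
  have hc : ContinuousOn (fun r : ℝ => svLi3 (r : ℂ)⁻¹ - svLi3 r) (Set.Icc 1 r) := by
    intro u hu
    rcases eq_or_lt_of_le hu.1 with rfl | h
    · exact h1.continuousWithinAt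
    · exact (hd u h).continuousAt.continuousWithinAt
  obtain ⟨c, -, h⟩ := exists_hasDerivAt_eq_slope _ (fun _ => (0 : ℝ)) hr hc
    (fun u hu => hd u hu.1)
  rw [eq_comm, div_eq_zero_iff] at h
  rcases h with h | h
  · simp only [Complex.ofReal_one, inv_one, sub_self, sub_zero] at h
    linarith
  · linarith

theorem svLi3_inv {w : ℂ} (h0 : w ≠ 0) : svLi3 w⁻¹ = svLi3 w := by
  by_cases hw : w ∈ posCutPlane
  · exact svLi3_inv_of_mem hw
  · obtain ⟨r, hr, rfl⟩ := eq_ofReal_of_notMem_posCutPlane hw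
    have hr0 : 0 < r := lt_of_le_of_ne hr (by rintro rfl; simp at h0)
    rcases lt_trichotomy r 1 with h | rfl | h
    · have := svLi3_inv_ofReal (one_lt_inv_iff₀.2 ⟨hr0, h⟩)
      simpa using this.symm
    · simp
    · exact svLi3_inv_ofReal h

theorem hasDerivAt_svLi3 {f : ℝ → ℂ} {f' : ℂ} {s : ℝ} (hf : HasDerivAt f f' s)
    (h0 : f s ≠ 0) (h1 : f s ≠ 1) :
    HasDerivAt (fun s => svLi3 (f s)) (dSvLi3 (f s) f') s := by
  by_cases hc : f s ∈ cutPlane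
  · exact hasDerivAt_svLi3_of_mem hf hc h0
  · have := hasDerivAt_svLi3_of_mem (hf.inv h0) (inv_mem_cutPlane_of_notMem hc h1)
      (inv_ne_zero h0)
    simp only [Pi.inv_apply] at this
    rw [dSvLi3_inv h0 h1] at this
    refine this.congr_of_eventuallyEq ?_
    filter_upwards [hf.continuousAt.eventually_ne h0] with u hu
    exact (svLi3_inv hu).symm

/-! ### Iterated integrals as functions of the upper end point -/

theorem iterInt_append (γ : ℝ → ℂ) (l : List ℂ) (b : ℂ) :
    iterInt γ (l ++ [b]) =
      fun s => ∫ u in (0 : ℝ)..s, iterInt γ l u * (deriv γ u / (γ u - b)) := by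
  simp [iterInt, List.foldl_append]

theorem iterInt_append_zero (γ : ℝ → ℂ) (l : List ℂ) (b : ℂ) : iterInt γ (l ++ [b]) 0 = 0 := by
  simp [iterInt_append]

theorem hasDerivAt_iterInt_append_of_continuousOn {γ : ℝ → ℂ} (hγ : ContDiff ℝ 1 γ)
    {α β : ℝ} (h0 : (0 : ℝ) ∈ Set.Ioo α β) {l : List ℂ} {b : ℂ}
    (hl : ContinuousOn (iterInt γ l) (Set.Ioo α β)) (hb : ∀ u ∈ Set.Ioo α β, γ u ≠ b)
    {s : ℝ} (hs : s ∈ Set.Ioo α β) :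
    HasDerivAt (iterInt γ (l ++ [b])) (iterInt γ l s * (deriv γ s / (γ s - b))) s := by
  have hc : ContinuousOn (fun u => iterInt γ l u * (deriv γ u / (γ u - b))) (Set.Ioo α β) :=
    hl.mul (((hγ.continuous_deriv le_rfl).continuousOn).div
      (hγ.continuous.continuousOn.sub continuousOn_const) fun u hu => sub_ne_zero.2 (hb u hu))
  rw [iterInt_append]
  refine intervalIntegral.integral_hasDerivAt_right ?_
    (hc.stronglyMeasurableAtFilter isOpen_Ioo s hs) (hc.continuousAt (isOpen_Ioo.mem_nhds hs))
  exact (hc.mono (Set.ordConnected_Ioo.uIcc_subset h0 hs)).intervalIntegrable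

theorem continuousOn_iterInt {γ : ℝ → ℂ} (hγ : ContDiff ℝ 1 γ) {α β : ℝ}
    (h0 : (0 : ℝ) ∈ Set.Ioo α β) (l : List ℂ)
    (hl : ∀ b ∈ l, ∀ u ∈ Set.Ioo α β, γ u ≠ b) :
    ContinuousOn (iterInt γ l) (Set.Ioo α β) := by
  induction l using List.reverseRecOn with
  | nil => exact continuousOn_const
  | append_singleton l b ih =>
    intro s hs
    exact (hasDerivAt_iterInt_append_of_continuousOn hγ h0
      (ih fun c hc => hl c (by simp [hc])) (hl b (by simp)) hs).continuousAt.continuousWithinAt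

/-- A path avoiding points on [0,1] still avoids them on a slightly larger open interval; this gives
two-sided derivatives at 0 and 1. -/
theorem exists_Ioo_of_isOpen {O : Set ℝ} (hO : IsOpen O) (h : Set.Icc (0 : ℝ) 1 ⊆ O) :
    ∃ ε > 0, Set.Ioo (-ε) (1 + ε) ⊆ O := by
  obtain ⟨ε, hε, hsub⟩ := isCompact_Icc.exists_thickening_subset_open hO h
  refine ⟨ε, hε, fun u hu => hsub ?_⟩
  rw [Metric.mem_thickening_iff]
  -- The witness is the point of [0,1] nearest to u.
  refine ⟨max 0 (min u 1), ⟨le_max_left _ _, max_le zero_le_one (min_le_right _ _)⟩, ?_⟩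
  rw [Real.dist_eq, abs_lt]
  rcases le_total u 1 with h1 | h1 <;> rcases le_total 0 u with h2 | h2 <;>
    simp only [h1, h2, min_eq_left, min_eq_right, max_eq_left, max_eq_right, zero_le_one] <;>
    constructor <;> linarith [hu.1, hu.2]

/-- `γ` avoids the point `b` on the unit interval. -/
def Avoids (γ : ℝ → ℂ) (b : ℂ) : Prop := ∀ u ∈ Set.Icc (0 : ℝ) 1, γ u ≠ b

theorem hasDerivAt_iterInt_append {γ : ℝ → ℂ} (hγ : ContDiff ℝ 1 γ) {l : List ℂ} {b : ℂ}
    (h : ∀ c ∈ l ++ [b], Avoids γ c) {s : ℝ} (hs : s ∈ Set.Icc (0 : ℝ) 1) :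
    HasDerivAt (iterInt γ (l ++ [b])) (iterInt γ l s * (deriv γ s / (γ s - b))) s := by
  have hfin : (⋂ c ∈ {c | c ∈ l ++ [b]}, {u : ℝ | γ u ≠ c}) = {u | ∀ c ∈ l ++ [b], γ u ≠ c} := by
    ext u
    simp
  have hO : IsOpen {u | ∀ c ∈ l ++ [b], γ u ≠ c} := by
    rw [← hfin]
    exact (List.finite_toSet _).isOpen_biInter fun c _ =>
      isOpen_ne_fun hγ.continuous continuous_const
  obtain ⟨ε, hε, hsub⟩ := exists_Ioo_of_isOpen hO fun u hu c hc => h c hc u hu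
  have h0 : (0 : ℝ) ∈ Set.Ioo (-ε) (1 + ε) := ⟨by linarith, by linarith⟩
  exact hasDerivAt_iterInt_append_of_continuousOn hγ h0
    (continuousOn_iterInt hγ h0 l fun c hc u hu => hsub hu c (by simp [hc]))
    (fun u hu => hsub hu b (by simp)) ⟨by linarith [hs.1], by linarith [hs.2]⟩

theorem hasDerivAt_of_contDiff {γ : ℝ → ℂ} (hγ : ContDiff ℝ 1 γ) (s : ℝ) :
    HasDerivAt γ (deriv γ s) s :=
  (hγ.differentiable one_ne_zero s).hasDerivAt

section

variable {γ : ℝ → ℂ} (hγ : ContDiff ℝ 1 γ) {a b c : ℂ} {s : ℝ} (hs : s ∈ Set.Icc (0 : ℝ) 1)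

include hγ hs

theorem hasDerivAt_iterInt_one (ha : Avoids γ a) :
    HasDerivAt (iterInt γ [a]) (deriv γ s / (γ s - a)) s := by
  have := hasDerivAt_iterInt_append hγ (l := []) (b := a) (by simpa using ha) hs
  simpa [iterInt] using this

theorem hasDerivAt_iterInt_two (ha : Avoids γ a) (hb : Avoids γ b) :
    HasDerivAt (iterInt γ [a, b]) (iterInt γ [a] s * (deriv γ s / (γ s - b))) s :=
  hasDerivAt_iterInt_append hγ (l := [a]) (b := b) (by simpa using ⟨ha, hb⟩) hs

theorem hasDerivAt_iterInt_three (ha : Avoids γ a) (hb : Avoids γ b) (hc : Avoids γ c) :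
    HasDerivAt (iterInt γ [a, b, c]) (iterInt γ [a, b] s * (deriv γ s / (γ s - c))) s :=
  hasDerivAt_iterInt_append hγ (l := [a, b]) (b := c) (by simpa using ⟨ha, hb, hc⟩) hs

/-- The real part does not see how γ winds around a, so it depends only on the end points. -/
theorem re_iterInt_one (ha : Avoids γ a) :
    (iterInt γ [a] s).re = Real.log ‖γ s - a‖ - Real.log ‖γ 0 - a‖ := by
  have h := constant_of_hasDerivAt_zero
    (h := fun s => (iterInt γ [a] s).re - Real.log ‖γ s - a‖) hs.1 ?_
  · have h0 : iterInt γ [a] 0 = 0 := iterInt_append_zero γ [] a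
    simp only [h0, Complex.zero_re] at h
    linarith
  · intro u hu
    have hu1 : u ∈ Set.Icc (0 : ℝ) 1 := ⟨hu.1, hu.2.trans hs.2⟩
    refine ((hasDerivAt_re_comp (hasDerivAt_iterInt_one hγ hu1 ha)).sub
      (hasDerivAt_log_norm ((hasDerivAt_of_contDiff hγ u).sub_const a)
        (sub_ne_zero.2 (ha u hu1)))).congr_deriv ?_
    ring

/-- The imaginary part of a double iterated integral, up to the imaginary parts of simple
integrals, is a difference of values of the Bloch–Wigner dilogarithm. -/
theorem im_iterInt_two (hbc : b ≠ c) (hb : Avoids γ b) (hc : Avoids γ c) :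
    (iterInt γ [b, c] s).im =
      (iterInt γ [b] s).im * (Real.log ‖γ s - c‖ - Real.log ‖c - b‖)
        - (iterInt γ [c] s).im * (Real.log ‖γ 0 - b‖ - Real.log ‖c - b‖)
        + blochWigner ((γ s - b) / (c - b)) - blochWigner ((γ 0 - b) / (c - b)) := by
  have hcb : c - b ≠ 0 := sub_ne_zero.2 hbc.symm
  -- The affine map sending b, c to 0, 1 turns dD into log|γ-b| d arg(γ-c) - log|γ-c| d arg(γ-b), up
  -- to the constants log|c-b|. The first part comes from Re I_b; the second completes Im I_b · d
  -- log|γ-c| to an exact differential.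
  have h := constant_of_hasDerivAt_zero
    (h := fun s => (iterInt γ [b, c] s).im -
      (iterInt γ [b] s).im * (Real.log ‖γ s - c‖ - Real.log ‖c - b‖)
        + (iterInt γ [c] s).im * (Real.log ‖γ 0 - b‖ - Real.log ‖c - b‖)
        - blochWigner ((γ s - b) / (c - b))) hs.1 ?_
  · have h0 : iterInt γ [b, c] 0 = 0 := iterInt_append_zero γ [b] c
    have h1 : iterInt γ [b] 0 = 0 := iterInt_append_zero γ [] b
    have h2 : iterInt γ [c] 0 = 0 := iterInt_append_zero γ [] c
    simp only [h0, h1, h2, Complex.zero_im] at h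
    linarith
  · intro u hu
    have hu1 : u ∈ Set.Icc (0 : ℝ) 1 := ⟨hu.1, hu.2.trans hs.2⟩
    have hd := hasDerivAt_of_contDiff hγ u
    have hub : γ u - b ≠ 0 := sub_ne_zero.2 (hb u hu1)
    have huc : γ u - c ≠ 0 := sub_ne_zero.2 (hc u hu1)
    have huc' : c - γ u ≠ 0 := sub_ne_zero.2 (hc u hu1).symm
    have e1 : 1 - (γ u - b) / (c - b) = (c - γ u) / (c - b) := by field_simp; ring
    have e2 : -(deriv γ u / (c - b)) / (1 - (γ u - b) / (c - b)) = deriv γ u / (γ u - c) := by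
      rw [e1, ← neg_sub (γ u) c]; field_simp
    have e3 : deriv γ u / (c - b) / ((γ u - b) / (c - b)) = deriv γ u / (γ u - b) := by
      field_simp
    have hD := hasDerivAt_blochWigner (((hd.sub_const b).div_const (c - b)))
      (div_ne_zero hub hcb) (fun h => huc' (by
        have h' := e1
        rw [h, sub_self, eq_comm, div_eq_zero_iff] at h'
        exact h'.resolve_right hcb))
    have h1 := hasDerivAt_im_comp (hasDerivAt_iterInt_one hγ hu1 hb)
    have h2 := hasDerivAt_im_comp (hasDerivAt_iterInt_one hγ hu1 hc)
    have h12 := hasDerivAt_im_comp (hasDerivAt_iterInt_two hγ hu1 hb hc)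
    have hl := hasDerivAt_log_norm (hd.sub_const c) huc
    refine (((h12.sub (h1.mul (hl.sub_const (Real.log ‖c - b‖)))).add
      (h2.mul_const _)).sub hD).congr_deriv ?_
    rw [dBlochWigner, e2, e3, e1, norm_div, norm_div,
      Real.log_div (norm_ne_zero_iff.2 hub) (norm_ne_zero_iff.2 hcb),
      Real.log_div (norm_ne_zero_iff.2 huc') (norm_ne_zero_iff.2 hcb), norm_sub_rev c (γ u),
      Complex.mul_im, re_iterInt_one hγ hu1 hb]
    ring

end

/-! ### Logarithmic derivatives along curves -/

/-- The curve `f` does not vanish at `s`, where `log ‖f‖ = a` and its logarithmic derivative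
is `α`. -/
structure HasLogDeriv (f : ℝ → ℂ) (s : ℝ) (a : ℝ) (α : ℂ) : Prop where
  ne_zero : f s ≠ 0
  hasDerivAt : HasDerivAt f (f s * α) s
  log_norm : Real.log ‖f s‖ = a

namespace HasLogDeriv

variable {f g : ℝ → ℂ} {s a b : ℝ} {α β : ℂ}

theorem of_hasDerivAt {f' : ℂ} (hf : HasDerivAt f f' s) (h0 : f s ≠ 0) :
    HasLogDeriv f s (Real.log ‖f s‖) (f' / f s) :=
  ⟨h0, by rwa [mul_div_cancel₀ _ h0], rfl⟩

theorem const {c : ℂ} (hc : c ≠ 0) (s : ℝ) : HasLogDeriv (fun _ => c) s (Real.log ‖c‖) 0 :=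
  ⟨hc, by simpa using hasDerivAt_const s c, rfl⟩

theorem mul (hf : HasLogDeriv f s a α) (hg : HasLogDeriv g s b β) :
    HasLogDeriv (fun u => f u * g u) s (a + b) (α + β) :=
  ⟨mul_ne_zero hf.ne_zero hg.ne_zero,
    (hf.hasDerivAt.mul hg.hasDerivAt).congr_deriv (by ring),
    by rw [norm_mul, Real.log_mul (norm_ne_zero_iff.2 hf.ne_zero) (norm_ne_zero_iff.2 hg.ne_zero),
      hf.log_norm, hg.log_norm]⟩

theorem div (hf : HasLogDeriv f s a α) (hg : HasLogDeriv g s b β) :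
    HasLogDeriv (fun u => f u / g u) s (a - b) (α - β) :=
  ⟨div_ne_zero hf.ne_zero hg.ne_zero,
    (hf.hasDerivAt.div hg.hasDerivAt hg.ne_zero).congr_deriv
      (by have := hg.ne_zero; field_simp),
    by rw [norm_div, Real.log_div (norm_ne_zero_iff.2 hf.ne_zero) (norm_ne_zero_iff.2 hg.ne_zero),
      hf.log_norm, hg.log_norm]⟩

theorem congr (hf : HasLogDeriv f s a α) (h : g =ᶠ[nhds s] f) (hab : b = a) (hαβ : β = α) :
    HasLogDeriv g s b β := by
  subst hab hαβ
  exact ⟨h.eq_of_nhds ▸ hf.ne_zero, by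
    rw [h.eq_of_nhds]; exact hf.hasDerivAt.congr_of_eventuallyEq h,
    by rw [h.eq_of_nhds]; exact hf.log_norm⟩

theorem hasDerivAt_log (hf : HasLogDeriv f s a α) :
    HasDerivAt (fun s => Real.log ‖f s‖) α.re s :=
  (hasDerivAt_log_norm hf.hasDerivAt hf.ne_zero).congr_deriv
    (by rw [mul_div_cancel_left₀ _ hf.ne_zero])

theorem eventually_ne_zero (hf : HasLogDeriv f s a α) : ∀ᶠ u in nhds s, f u ≠ 0 :=
  hf.hasDerivAt.continuousAt.eventually_ne hf.ne_zero

variable (hf : HasLogDeriv f s a α) (hf1 : HasLogDeriv (fun u => 1 - f u) s b β)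

include hf hf1

theorem neg_div_one_sub : -(f s * α) / (1 - f s) = β := by
  have h := (hf.hasDerivAt.const_sub 1).unique hf1.hasDerivAt
  rw [h]
  exact mul_div_cancel_left₀ _ hf1.ne_zero

/-- The differentials of D and ℒ₃ at f involve only the logarithmic data of f and 1 - f. For the
arguments below both factor into constants and powers of 1 - xyZ, 1 - yZ, 1 - Z, so the later
derivative checks are polynomial identities. -/
theorem hasDerivAt_blochWigner :
    HasDerivAt (fun s => blochWigner (f s)) (a * β.im - b * α.im) s := by
  refine (TripleLog.hasDerivAt_blochWigner hf.hasDerivAt hf.ne_zero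
    (sub_ne_zero.1 hf1.ne_zero).symm).congr_deriv ?_
  rw [dBlochWigner, neg_div_one_sub hf hf1, mul_div_cancel_left₀ _ hf.ne_zero, hf.log_norm,
    hf1.log_norm]

theorem hasDerivAt_svLi3 :
    HasDerivAt (fun s => svLi3 (f s))
      (-blochWigner (f s) * α.im + 1 / 3 * a * (b * α.re - a * β.re)) s := by
  refine (TripleLog.hasDerivAt_svLi3 hf.hasDerivAt hf.ne_zero
    (sub_ne_zero.1 hf1.ne_zero).symm).congr_deriv ?_
  rw [dSvLi3, neg_div_one_sub hf hf1, mul_div_cancel_left₀ _ hf.ne_zero, hf.log_norm,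
    hf1.log_norm]

end HasLogDeriv

/-! ### The arguments of the trilogarithms -/

/-- The argument `(y-1)(1-xyz)/(y(1-x)(1-z))`. -/
noncomputable def arg₁ (x y z : ℂ) : ℂ := (y - 1) * (1 - x * y * z) / (y * (1 - x) * (1 - z))

/-- The argument `(1-xyz)/(1-x)`. -/
noncomputable def arg₂ (x y z : ℂ) : ℂ := (1 - x * y * z) / (1 - x)

/-- The argument `(1-xyz)/(xy(1-z))`. -/
noncomputable def arg₃ (x y z : ℂ) : ℂ := (1 - x * y * z) / (x * y * (1 - z))

/-- The argument `(y-yz)/(y-1)`. -/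
noncomputable def arg₄ (y z : ℂ) : ℂ := (y - y * z) / (y - 1)

section arguments

variable {x y : ℂ} (hx : x ≠ 0) (hy : y ≠ 0) (hx1 : x ≠ 1) (hy1 : y ≠ 1) (hxy : x * y ≠ 1)
  {Z : ℝ → ℂ} {s p₁ p₂ p₃ : ℝ} {η₁ η₂ η₃ : ℂ}
  (h₁ : HasLogDeriv (fun u => 1 - x * y * Z u) s p₁ η₁)
  (h₂ : HasLogDeriv (fun u => 1 - y * Z u) s p₂ η₂)
  (h₃ : HasLogDeriv (fun u => 1 - Z u) s p₃ η₃)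

include hy hx1 hy1 h₁ h₃ in
theorem hasLogDeriv_arg₁ : HasLogDeriv (fun u => arg₁ x y (Z u)) s
    (Real.log ‖1 - y‖ + p₁ - Real.log ‖y‖ - Real.log ‖1 - x‖ - p₃) (η₁ - η₃) := by
  have hx1' : 1 - x ≠ 0 := sub_ne_zero.2 hx1.symm
  have hy1' : y - 1 ≠ 0 := sub_ne_zero.2 hy1
  refine (((HasLogDeriv.const hy1' s).mul h₁).div
    ((HasLogDeriv.const (mul_ne_zero hy hx1') s).mul h₃)).congr
    (Filter.Eventually.of_forall fun u => rfl) ?_ (by ring)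
  rw [norm_mul, Real.log_mul (norm_ne_zero_iff.2 hy) (norm_ne_zero_iff.2 hx1'), norm_sub_rev y]
  ring

-- The underlying factorisation is y(1-x)(1-z) - (y-1)(1-xyz) = (1-xy)(1-yz).
include hy hx1 hxy h₂ h₃ in
theorem hasLogDeriv_one_sub_arg₁ : HasLogDeriv (fun u => 1 - arg₁ x y (Z u)) s
    (Real.log ‖1 - x * y‖ + p₂ - Real.log ‖y‖ - Real.log ‖1 - x‖ - p₃) (η₂ - η₃) := by
  have hx1' : 1 - x ≠ 0 := sub_ne_zero.2 hx1.symm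
  have hxy' : 1 - x * y ≠ 0 := sub_ne_zero.2 hxy.symm
  refine (((HasLogDeriv.const hxy' s).mul h₂).div
    ((HasLogDeriv.const (mul_ne_zero hy hx1') s).mul h₃)).congr ?_ ?_ (by ring)
  · filter_upwards [h₃.eventually_ne_zero] with u hu
    rw [arg₁]
    field_simp
    ring
  · rw [norm_mul, Real.log_mul (norm_ne_zero_iff.2 hy) (norm_ne_zero_iff.2 hx1')]
    ring

include hx1 h₁ in
theorem hasLogDeriv_arg₂ : HasLogDeriv (fun u => arg₂ x y (Z u)) s
    (p₁ - Real.log ‖1 - x‖) η₁ := by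
  have hx1' : 1 - x ≠ 0 := sub_ne_zero.2 hx1.symm
  exact (h₁.div (HasLogDeriv.const hx1' s)).congr
    (Filter.Eventually.of_forall fun u => rfl) rfl (by ring)

include hx hx1 h₂ in
theorem hasLogDeriv_one_sub_arg₂ : HasLogDeriv (fun u => 1 - arg₂ x y (Z u)) s
    (Real.log ‖x‖ + p₂ - Real.log ‖1 - x‖) η₂ := by
  have hx1' : 1 - x ≠ 0 := sub_ne_zero.2 hx1.symm
  refine (((HasLogDeriv.const (neg_ne_zero.2 hx) s).mul h₂).div (HasLogDeriv.const hx1' s)).congr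
    (Filter.Eventually.of_forall fun u => ?_) (by rw [norm_neg]) (by ring)
  simp only [arg₂]
  field_simp
  ring

include hx hy h₁ h₃ in
theorem hasLogDeriv_arg₃ : HasLogDeriv (fun u => arg₃ x y (Z u)) s
    (p₁ - Real.log ‖x‖ - Real.log ‖y‖ - p₃) (η₁ - η₃) := by
  refine (h₁.div ((HasLogDeriv.const (mul_ne_zero hx hy) s).mul h₃)).congr
    (Filter.Eventually.of_forall fun u => rfl) ?_ (by ring)
  rw [norm_mul, Real.log_mul (norm_ne_zero_iff.2 hx) (norm_ne_zero_iff.2 hy)]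
  ring

include hx hy hxy h₃ in
theorem hasLogDeriv_one_sub_arg₃ : HasLogDeriv (fun u => 1 - arg₃ x y (Z u)) s
    (Real.log ‖1 - x * y‖ - Real.log ‖x‖ - Real.log ‖y‖ - p₃) (-η₃) := by
  have hxy' : 1 - x * y ≠ 0 := sub_ne_zero.2 hxy.symm
  refine ((HasLogDeriv.const (neg_ne_zero.2 hxy') s).div
    ((HasLogDeriv.const (mul_ne_zero hx hy) s).mul h₃)).congr ?_ ?_ (by ring)
  · filter_upwards [h₃.eventually_ne_zero] with u hu
    rw [arg₃]
    field_simp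
    ring
  · rw [norm_mul, Real.log_mul (norm_ne_zero_iff.2 hx) (norm_ne_zero_iff.2 hy), norm_neg]
    ring

include hy hy1 h₃ in
theorem hasLogDeriv_arg₄ : HasLogDeriv (fun u => arg₄ y (Z u)) s
    (Real.log ‖y‖ + p₃ - Real.log ‖1 - y‖) η₃ := by
  have hy1' : y - 1 ≠ 0 := sub_ne_zero.2 hy1
  refine (((HasLogDeriv.const hy s).mul h₃).div (HasLogDeriv.const hy1' s)).congr
    (Filter.Eventually.of_forall fun u => ?_) (by rw [norm_sub_rev y]) (by ring)
  simp only [arg₄]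
  ring

include hy1 h₂ in
theorem hasLogDeriv_one_sub_arg₄ : HasLogDeriv (fun u => 1 - arg₄ y (Z u)) s
    (p₂ - Real.log ‖1 - y‖) η₂ := by
  have hy1' : y - 1 ≠ 0 := sub_ne_zero.2 hy1
  have hy2' : 1 - y ≠ 0 := sub_ne_zero.2 hy1.symm
  refine (h₂.div (HasLogDeriv.const hy2' s)).congr
    (Filter.Eventually.of_forall fun u => ?_) rfl (by ring)
  simp only [arg₄]
  rw [← neg_sub y 1]
  field_simp
  ring

/-! ### The five-term relation -/

include hx hy hx1 hy1 hxy in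
/-- The five-term relation of the Bloch–Wigner dilogarithm. -/
theorem blochWigner_five_term {z : ℂ} (hz : z ≠ 1) (hyz : y * z ≠ 1) (hxyz : x * y * z ≠ 1) :
    blochWigner (arg₁ x y z) + blochWigner (arg₄ y z) =
      blochWigner (arg₂ x y z) + blochWigner (arg₃ x y z)
        - blochWigner ((1 - x) / (x * (y - 1))) := by
  have hx1' : 1 - x ≠ 0 := sub_ne_zero.2 hx1.symm
  have hy1' : y - 1 ≠ 0 := sub_ne_zero.2 hy1
  set F : ℂ → ℝ := fun w => blochWigner (arg₁ x y w) + blochWigner (arg₄ y w)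
    - blochWigner (arg₂ x y w) - blochWigner (arg₃ x y w) with hF
  set S : Set ℂ := {1, y⁻¹, (x * y)⁻¹} with hSdef
  have hS : S.Finite := by simp [hSdef]
  have hmem : ∀ w : ℂ, w ∈ Sᶜ ↔ 1 - w ≠ 0 ∧ 1 - y * w ≠ 0 ∧ 1 - x * y * w ≠ 0 := by
    intro w
    have hinv : ∀ {c : ℂ}, c ≠ 0 → (w = c⁻¹ ↔ c * w = 1) := fun hc => by
      rw [← eq_inv_mul_iff_mul_eq₀ hc, mul_one]
    simp only [hSdef, Set.mem_compl_iff, Set.mem_insert_iff, Set.mem_singleton_iff, not_or,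
      sub_ne_zero, ne_comm (a := (1 : ℂ)), hinv hy, ne_eq, hinv (mul_ne_zero hx hy)]
  have hconst : ∀ w ∈ Sᶜ, F w = F z := by
    intro w hw
    refine eq_of_hasDerivAt_lines_zero hS.isClosed.isOpen_compl
      (isPreconnected_compl_of_finite hS) ?_ hw
      ((hmem z).2 ⟨sub_ne_zero.2 hz.symm, sub_ne_zero.2 hyz.symm, sub_ne_zero.2 hxyz.symm⟩)
    intro w v s hs
    obtain ⟨k3, k2, k1⟩ := (hmem _).1 hs
    have hl := hasDerivAt_line w v s
    have h₁ := HasLogDeriv.of_hasDerivAt ((hl.const_mul (x * y)).const_sub 1) k1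
    have h₂ := HasLogDeriv.of_hasDerivAt ((hl.const_mul y).const_sub 1) k2
    have h₃ := HasLogDeriv.of_hasDerivAt (hl.const_sub 1) k3
    refine (((((hasLogDeriv_arg₁ hy hx1 hy1 h₁ h₃).hasDerivAt_blochWigner
      (hasLogDeriv_one_sub_arg₁ hy hx1 hxy h₂ h₃)).add
      ((hasLogDeriv_arg₄ hy hy1 h₃).hasDerivAt_blochWigner
        (hasLogDeriv_one_sub_arg₄ hy1 h₂))).sub
      ((hasLogDeriv_arg₂ hx1 h₁).hasDerivAt_blochWigner
        (hasLogDeriv_one_sub_arg₂ hx hx1 h₂))).sub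
      ((hasLogDeriv_arg₃ hx hy h₁ h₃).hasDerivAt_blochWigner
        (hasLogDeriv_one_sub_arg₃ hx hy hxy h₃))).congr_deriv ?_
    simp only [Complex.sub_im, Complex.neg_im]
    ring
  -- The constant is found at w = 1/y, where three of the arguments equal 1 and D(1) = 0. This point
  -- is excluded from the domain of constancy, so it is reached by continuity of D and density of
  -- the complement of S.
  have hb3 : 1 - y⁻¹ ≠ 0 := sub_ne_zero.2 (fun h => hy1 (inv_eq_one.1 h.symm))
  have hb1 : 1 - x * y * y⁻¹ ≠ 0 := by rwa [mul_inv_cancel_right₀ hy]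
  have e1 : arg₁ x y y⁻¹ = 1 := by
    rw [arg₁, mul_inv_cancel_right₀ hy]; field_simp
  have e2 : arg₂ x y y⁻¹ = 1 := by
    rw [arg₂, mul_inv_cancel_right₀ hy]; field_simp
  have e3 : arg₃ x y y⁻¹ = (1 - x) / (x * (y - 1)) := by
    rw [arg₃, mul_inv_cancel_right₀ hy]
    congr 1
    field_simp
  have e4 : arg₄ y y⁻¹ = 1 := by
    rw [arg₄, mul_inv_cancel₀ hy]; field_simp
  have hcont : ContinuousAt F y⁻¹ := by
    have c1 : ContinuousAt (fun w => arg₁ x y w) y⁻¹ := by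
      unfold arg₁
      exact ContinuousAt.div (by fun_prop) (by fun_prop) (mul_ne_zero (mul_ne_zero hy hx1') hb3)
    have c2 : ContinuousAt (fun w => arg₂ x y w) y⁻¹ := by
      unfold arg₂
      fun_prop
    have c3 : ContinuousAt (fun w => arg₃ x y w) y⁻¹ := by
      unfold arg₃
      exact ContinuousAt.div (by fun_prop) (by fun_prop) (mul_ne_zero (mul_ne_zero hx hy) hb3)
    have c4 : ContinuousAt (fun w => arg₄ y w) y⁻¹ := by
      unfold arg₄
      fun_prop
    exact (((continuous_blochWigner.continuousAt.comp c1).add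
      (continuous_blochWigner.continuousAt.comp c4)).sub
      (continuous_blochWigner.continuousAt.comp c2)).sub
      (continuous_blochWigner.continuousAt.comp c3)
  have hval : F y⁻¹ = F z := by
    have hcl : y⁻¹ ∈ closure Sᶜ := by
      rw [(hS.countable.dense_compl ℝ).closure_eq]
      trivial
    have : (nhdsWithin y⁻¹ Sᶜ).NeBot := mem_closure_iff_nhdsWithin_neBot.1 hcl
    refine tendsto_nhds_unique (l := nhdsWithin y⁻¹ Sᶜ) (f := F) (hcont.tendsto.mono_left nhdsWithin_le_nhds)
      (tendsto_const_nhds.congr' ?_)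
    filter_upwards [self_mem_nhdsWithin] with w hw
    exact (hconst w hw).symm
  simp only [hF, e1, e2, e3, e4, blochWigner_one] at hval
  linarith

end arguments

/-! ### The triple integral along a path -/

section path

variable {x y z : ℂ} {γ : ℝ → ℂ}

theorem one_sub_mul_eq {c w : ℂ} (hc : c ≠ 0) : 1 - c * w = (w - c⁻¹) / (0 - c⁻¹) := by
  field_simp
  ring

theorem hasLogDeriv_one_sub_mul {c : ℂ} (hc : c ≠ 0) {s : ℝ} (hd : HasDerivAt γ (deriv γ s) s)
    (h : γ s ≠ c⁻¹) :
    HasLogDeriv (fun u => 1 - c * γ u) s (Real.log ‖1 - c * γ s‖) (deriv γ s / (γ s - c⁻¹)) := by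
  have h0 : γ s - c⁻¹ ≠ 0 := sub_ne_zero.2 h
  have h1 : 1 - c * γ s ≠ 0 := by
    rw [one_sub_mul_eq hc]
    exact div_ne_zero h0 (by simpa using hc)
  refine (HasLogDeriv.of_hasDerivAt ((hd.const_mul c).const_sub 1) h1).congr
    Filter.EventuallyEq.rfl rfl ?_
  rw [div_eq_div_iff h0 h1]
  field_simp
  ring

theorem re_iterInt_inv (hγ : ContDiff ℝ 1 γ) (h0 : γ 0 = 0) {c : ℂ} (hc : c ≠ 0)
    (ha : Avoids γ c⁻¹) {s : ℝ} (hs : s ∈ Set.Icc (0 : ℝ) 1) :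
    (iterInt γ [c⁻¹] s).re = Real.log ‖1 - c * γ s‖ := by
  rw [re_iterInt_one hγ hs ha, one_sub_mul_eq hc, norm_div, Real.log_div, h0]
  · exact norm_ne_zero_iff.2 (sub_ne_zero.2 (ha s hs))
  · simpa using hc

theorem log_norm_sub_inv {c w : ℂ} (hc : c ≠ 0) (hw : w ≠ c⁻¹) :
    Real.log ‖w - c⁻¹‖ = Real.log ‖1 - c * w‖ - Real.log ‖c‖ := by
  rw [one_sub_mul_eq hc, norm_div, Real.log_div (norm_ne_zero_iff.2 (sub_ne_zero.2 hw))
    (by simpa using hc), zero_sub, norm_neg, norm_inv, Real.log_inv]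
  ring

theorem log_norm_mul {a b : ℂ} (ha : a ≠ 0) (hb : b ≠ 0) :
    Real.log ‖a * b‖ = Real.log ‖a‖ + Real.log ‖b‖ := by
  rw [norm_mul, Real.log_mul (norm_ne_zero_iff.2 ha) (norm_ne_zero_iff.2 hb)]

theorem log_norm_div {a b : ℂ} (ha : a ≠ 0) (hb : b ≠ 0) :
    Real.log ‖a / b‖ = Real.log ‖a‖ - Real.log ‖b‖ := by
  rw [norm_div, Real.log_div (norm_ne_zero_iff.2 ha) (norm_ne_zero_iff.2 hb)]

/-- The real part of the triple iterated integral along `γ` up to `s`, corrected by products of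
integrals of lower depth, plus the combination of trilogarithms that it cancels. -/
noncomputable def tripleDefect (x y z : ℂ) (γ : ℝ → ℂ) (s : ℝ) : ℝ :=
    (iterInt γ [(x * y * z)⁻¹, (y * z)⁻¹, z⁻¹] s).re
      - Real.log ‖1 - x‖ * (iterInt γ [(y * z)⁻¹, z⁻¹] s).re
      - (Real.log ‖x‖ + Real.log ‖1 - y‖ - Real.log ‖1 - x‖) *
          (iterInt γ [(x * y * z)⁻¹, z⁻¹] s).re
      - (Real.log ‖1 - z * γ s‖ + Real.log ‖y‖ - Real.log ‖1 - y‖) *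
          (iterInt γ [(x * y * z)⁻¹, (y * z)⁻¹] s).re
      - (blochWigner x - blochWigner ((1 - x) / (x * (y - 1)))) * (iterInt γ [z⁻¹] s).im
      - (blochWigner (arg₄ y (z * γ s)) + blochWigner ((1 - x) / (x * (y - 1)))) *
          (iterInt γ [(x * y * z)⁻¹] s).im
      + 1 / 3 * (Real.log ‖1 - x‖ * Real.log ‖1 - y‖ * Real.log ‖1 - z * γ s‖
        + 2 * Real.log ‖1 - x‖ * ((Real.log ‖1 - z * γ s‖ + Real.log ‖y‖ - Real.log ‖1 - y‖) *
            Real.log ‖1 - y * z * γ s‖)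
        + (Real.log ‖x‖ + Real.log ‖1 - y‖ - Real.log ‖1 - x‖) * Real.log ‖1 - x * y‖ *
            Real.log ‖1 - z * γ s‖
        + (Real.log ‖x‖ + Real.log ‖1 - y‖ - Real.log ‖1 - x‖) *
            ((Real.log ‖1 - z * γ s‖ + (Real.log ‖x‖ + Real.log ‖y‖ - Real.log ‖1 - x * y‖)) *
            Real.log ‖1 - x * y * z * γ s‖)
        + (Real.log ‖1 - z * γ s‖ + Real.log ‖y‖ - Real.log ‖1 - y‖) *
            ((Real.log ‖1 - y * z * γ s‖ + (Real.log ‖x‖ - Real.log ‖1 - x‖)) *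
            Real.log ‖1 - x * y * z * γ s‖))
      + (svLi3 (arg₁ x y (z * γ s)) + svLi3 (y / (y - 1)) + svLi3 (x * y)
        - svLi3 (arg₂ x y (z * γ s)) - svLi3 (arg₃ x y (z * γ s)) - svLi3 (arg₄ y (z * γ s))
        - svLi3 ((y - x * y) / (y - 1)) + svLi3 (1 - x))

variable (hx : x ≠ 0) (hy : y ≠ 0) (hz : z ≠ 0) (hx1 : x ≠ 1) (hy1 : y ≠ 1) (hxy : x * y ≠ 1)
  (hγ : ContDiff ℝ 1 γ) (h0 : γ 0 = 0)
  (ha₁ : Avoids γ (x * y * z)⁻¹) (ha₂ : Avoids γ (y * z)⁻¹) (ha₃ : Avoids γ z⁻¹)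

-- This is `im_iterInt_two` at the first two nodes. The starting point 0 contributes D(1/(1-x)),
-- which is D(x).
include hx hy hz hx1 hγ h0 ha₁ ha₂ in
theorem im_iterInt_inv_inv {s : ℝ} (hs : s ∈ Set.Icc (0 : ℝ) 1) :
    (iterInt γ [(x * y * z)⁻¹, (y * z)⁻¹] s).im =
      (iterInt γ [(x * y * z)⁻¹] s).im *
          (Real.log ‖1 - y * z * γ s‖ + Real.log ‖x‖ - Real.log ‖1 - x‖)
        + (iterInt γ [(y * z)⁻¹] s).im * Real.log ‖1 - x‖
        + blochWigner (arg₂ x y (z * γ s)) - blochWigner x := by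
  have hx1' : 1 - x ≠ 0 := sub_ne_zero.2 hx1.symm
  have hx1'' : x - 1 ≠ 0 := sub_ne_zero.2 hx1
  have hyz0 : y * z ≠ 0 := mul_ne_zero hy hz
  have hxyz0 : x * y * z ≠ 0 := mul_ne_zero (mul_ne_zero hx hy) hz
  have e0 : (y * z)⁻¹ - (x * y * z)⁻¹ = (x - 1) / (x * y * z) := by field_simp
  have hne : (x * y * z)⁻¹ ≠ (y * z)⁻¹ := by
    rw [ne_comm, ← sub_ne_zero, e0]
    exact div_ne_zero hx1'' hxyz0
  have e1 : (γ s - (x * y * z)⁻¹) / ((y * z)⁻¹ - (x * y * z)⁻¹) = arg₂ x y (z * γ s) := by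
    rw [e0, arg₂, ← neg_sub x 1]
    field_simp
    ring
  have e2 : (γ 0 - (x * y * z)⁻¹) / ((y * z)⁻¹ - (x * y * z)⁻¹) = (1 - x)⁻¹ := by
    rw [e0, h0, ← neg_sub x 1]
    field_simp
    ring
  have e3 : Real.log ‖γ 0 - (x * y * z)⁻¹‖ = -(Real.log ‖x‖ + Real.log ‖y * z‖) := by
    rw [h0, zero_sub, norm_neg, norm_inv, Real.log_inv, mul_assoc, log_norm_mul hx hyz0]
  rw [im_iterInt_two hγ hs hne ha₁ ha₂, e1, e2, e3, e0, log_norm_sub_inv hyz0 (ha₂ s hs),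
    log_norm_div hx1'' hxyz0, mul_assoc x y z, log_norm_mul hx hyz0, norm_sub_rev x 1,
    blochWigner_inv, blochWigner_one_sub]
  ring

include hx hy hz hx1 hy1 hxy hγ h0 ha₁ ha₂ ha₃ in
/-- The value of the triple iterated integral along `γ`, up to products of integrals of lower
depth, in terms of the single-valued trilogarithm. -/
theorem re_iterInt_three {s : ℝ} (hs : s ∈ Set.Icc (0 : ℝ) 1) :
    tripleDefect x y z γ s = 0 := by
  have hx1' : 1 - x ≠ 0 := sub_ne_zero.2 hx1.symm
  have hy1' : y - 1 ≠ 0 := sub_ne_zero.2 hy1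
  have hyz0 : y * z ≠ 0 := mul_ne_zero hy hz
  have hxy0 : x * y ≠ 0 := mul_ne_zero hx hy
  have hxyz0 : x * y * z ≠ 0 := mul_ne_zero hxy0 hz
  refine (constant_of_hasDerivAt_zero (h := fun s => tripleDefect x y z γ s) hs.1
    (fun u hu => ?_)).trans ?_
  · have hu1 : u ∈ Set.Icc (0 : ℝ) 1 := ⟨hu.1, hu.2.trans hs.2⟩
    have hd := hasDerivAt_of_contDiff hγ u
    have l₁ := hasLogDeriv_one_sub_mul hxyz0 hd (ha₁ u hu1)
    have l₂ := hasLogDeriv_one_sub_mul hyz0 hd (ha₂ u hu1)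
    have l₃ := hasLogDeriv_one_sub_mul hz hd (ha₃ u hu1)
    have h₁ : HasLogDeriv (fun u => 1 - x * y * (z * γ u)) u _ _ :=
      l₁.congr (Filter.Eventually.of_forall fun v => by simp only [mul_assoc]) rfl rfl
    have h₂ : HasLogDeriv (fun u => 1 - y * (z * γ u)) u _ _ :=
      l₂.congr (Filter.Eventually.of_forall fun v => by simp only [mul_assoc]) rfl rfl
    have h5 := blochWigner_five_term hx hy hx1 hy1 hxy (z := z * γ u)
      (sub_ne_zero.1 l₃.ne_zero).symm (sub_ne_zero.1 h₂.ne_zero).symm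
      (sub_ne_zero.1 h₁.ne_zero).symm
    have him := im_iterInt_inv_inv hx hy hz hx1 hγ h0 ha₁ ha₂ hu1
    have r1 := re_iterInt_inv hγ h0 hxyz0 ha₁ hu1
    have r2 := re_iterInt_inv hγ h0 hyz0 ha₂ hu1
    have i1 := hasDerivAt_im_comp (hasDerivAt_iterInt_one hγ hu1 ha₁)
    have i3 := hasDerivAt_im_comp (hasDerivAt_iterInt_one hγ hu1 ha₃)
    have i12 := hasDerivAt_re_comp (hasDerivAt_iterInt_two hγ hu1 ha₁ ha₂)
    have i13 := hasDerivAt_re_comp (hasDerivAt_iterInt_two hγ hu1 ha₁ ha₃)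
    have i23 := hasDerivAt_re_comp (hasDerivAt_iterInt_two hγ hu1 ha₂ ha₃)
    have i123 := hasDerivAt_re_comp (hasDerivAt_iterInt_three hγ hu1 ha₁ ha₂ ha₃)
    have p1 := l₁.hasDerivAt_log
    have p2 := l₂.hasDerivAt_log
    have p3 := l₃.hasDerivAt_log
    have d4 := (hasLogDeriv_arg₄ hy hy1 l₃).hasDerivAt_blochWigner
      (hasLogDeriv_one_sub_arg₄ hy1 h₂)
    have t1 := (hasLogDeriv_arg₁ hy hx1 hy1 h₁ l₃).hasDerivAt_svLi3
      (hasLogDeriv_one_sub_arg₁ hy hx1 hxy h₂ l₃)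
    have t2 := (hasLogDeriv_arg₂ hx1 h₁).hasDerivAt_svLi3 (hasLogDeriv_one_sub_arg₂ hx hx1 h₂)
    have t3 := (hasLogDeriv_arg₃ hx hy h₁ l₃).hasDerivAt_svLi3
      (hasLogDeriv_one_sub_arg₃ hx hy hxy l₃)
    have t4 := (hasLogDeriv_arg₄ hy hy1 l₃).hasDerivAt_svLi3 (hasLogDeriv_one_sub_arg₄ hy1 h₂)
    have r76 := (p3.add_const (Real.log ‖y‖)).sub_const (Real.log ‖1 - y‖)
    unfold tripleDefect
    refine ((((((((i123.sub (i23.const_mul _)).sub (i13.const_mul _)).sub (r76.mul i12)).sub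
      (i3.const_mul _)).sub ((d4.add_const _).mul i1)).add
      ((((((p3.const_mul _).add ((r76.mul p2).const_mul _)).add (p3.const_mul _)).add
        (((p3.add_const _).mul p1).const_mul _)).add
        (r76.mul ((p2.add_const _).mul p1))).const_mul (1 / 3))).add
      (((((((t1.add_const _).add_const _).sub t2).sub t3).sub t4).sub_const _).add_const
        _))).congr_deriv ?_
    simp only [Complex.mul_re, Complex.sub_im, Complex.sub_re, Complex.neg_re,
      Pi.mul_apply, him, r1, r2]
    -- All D-terms collect, with this common factor, into the five-term combination at zγ(u); the
    -- remaining terms cancel as polynomials in logarithms.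
    linear_combination ((deriv γ u / (γ u - z⁻¹)).im - (deriv γ u / (γ u - (x * y * z)⁻¹)).im) * h5
  -- At γ(0) = 0 the integrals and the logarithms in γ vanish, and the eight trilogarithms cancel in
  -- pairs, three of the pairs having mutually inverse arguments.
  · have z1 : ∀ b, iterInt γ [b] 0 = 0 := iterInt_append_zero γ []
    have z2 : ∀ a b, iterInt γ [a, b] 0 = 0 := fun a => iterInt_append_zero γ [a]
    have z3 : ∀ a b c, iterInt γ [a, b, c] 0 = 0 := fun a b => iterInt_append_zero γ [a, b]
    have e1 : arg₁ x y 0 = ((y - x * y) / (y - 1))⁻¹ := by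
      rw [arg₁, inv_div]; congr 1 <;> ring
    have e2 : arg₂ x y 0 = (1 - x)⁻¹ := by simp [arg₂]
    have e3 : arg₃ x y 0 = (x * y)⁻¹ := by simp [arg₃]
    have e4 : arg₄ y 0 = y / (y - 1) := by simp [arg₄]
    have e5 : (y - x * y) / (y - 1) ≠ 0 :=
      div_ne_zero (by rw [show y - x * y = y * (1 - x) by ring]; exact mul_ne_zero hy hx1') hy1'
    simp only [tripleDefect, z1, z2, z3, h0, mul_zero, sub_zero, norm_one, Real.log_one, Complex.zero_re,
      Complex.zero_im, e1, e2, e3, e4, svLi3_inv e5, svLi3_inv hx1', svLi3_inv hxy0]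
    ring

end path

/-! ### The logarithm of the single-valued matrix -/

/-- The matrices supported on the pairs `j ≤ i` of indices in `{0,1}³`, with `d` on the diagonal. -/
def lowerMat (d e10 e20 e30 e40 e50 e60 e70 e41 e42 e51 e53 e62 e63 e71 e72 e73 e74 e75 e76 : ℂ) :
    Matrix (Fin 8) (Fin 8) ℂ :=
  !![d, 0, 0, 0, 0, 0, 0, 0;
     e10, d, 0, 0, 0, 0, 0, 0;
     e20, 0, d, 0, 0, 0, 0, 0;
     e30, 0, 0, d, 0, 0, 0, 0;
     e40, e41, e42, 0, d, 0, 0, 0;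
     e50, e51, 0, e53, 0, d, 0, 0;
     e60, 0, e62, e63, 0, 0, d, 0;
     e70, e71, e72, e73, e74, e75, e76, d]

/-- These matrices are closed under products because they lie in the incidence algebra of the poset
{0,1}³. -/
theorem lowerMat_mul
    (d e10 e20 e30 e40 e50 e60 e70 e41 e42 e51 e53 e62 e63 e71 e72 e73 e74 e75 e76
      c f10 f20 f30 f40 f50 f60 f70 f41 f42 f51 f53 f62 f63 f71 f72 f73 f74 f75 f76 : ℂ) :
    lowerMat d e10 e20 e30 e40 e50 e60 e70 e41 e42 e51 e53 e62 e63 e71 e72 e73 e74 e75 e76 *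
      lowerMat c f10 f20 f30 f40 f50 f60 f70 f41 f42 f51 f53 f62 f63 f71 f72 f73 f74 f75 f76 =
    lowerMat (d * c) (e10 * c + d * f10) (e20 * c + d * f20) (e30 * c + d * f30)
      (e40 * c + e41 * f10 + e42 * f20 + d * f40) (e50 * c + e51 * f10 + e53 * f30 + d * f50)
      (e60 * c + e62 * f20 + e63 * f30 + d * f60)
      (e70 * c + e71 * f10 + e72 * f20 + e73 * f30 + e74 * f40 + e75 * f50 + e76 * f60 + d * f70)
      (e41 * c + d * f41) (e42 * c + d * f42) (e51 * c + d * f51) (e53 * c + d * f53)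
      (e62 * c + d * f62) (e63 * c + d * f63) (e71 * c + e74 * f41 + e75 * f51 + d * f71)
      (e72 * c + e74 * f42 + e76 * f62 + d * f72) (e73 * c + e75 * f53 + e76 * f63 + d * f73)
      (e74 * c + d * f74) (e75 * c + d * f75) (e76 * c + d * f76) := by
  ext i j
  fin_cases i <;> fin_cases j <;>
    simp [lowerMat, Matrix.mul_apply, Fin.sum_univ_succ] <;> ring

theorem lowerMat_one_eq
    (e10 e20 e30 e40 e50 e60 e70 e41 e42 e51 e53 e62 e63 e71 e72 e73 e74 e75 e76 : ℂ) :
    lowerMat 1 e10 e20 e30 e40 e50 e60 e70 e41 e42 e51 e53 e62 e63 e71 e72 e73 e74 e75 e76 =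
      1 + lowerMat 0 e10 e20 e30 e40 e50 e60 e70 e41 e42 e51 e53 e62 e63 e71 e72 e73 e74 e75
        e76 := by
  ext i j
  fin_cases i <;> fin_cases j <;> simp [lowerMat]

theorem neg_lowerMat_zero
    (e10 e20 e30 e40 e50 e60 e70 e41 e42 e51 e53 e62 e63 e71 e72 e73 e74 e75 e76 : ℂ) :
    -lowerMat 0 e10 e20 e30 e40 e50 e60 e70 e41 e42 e51 e53 e62 e63 e71 e72 e73 e74 e75 e76 =
      lowerMat 0 (-e10) (-e20) (-e30) (-e40) (-e50) (-e60) (-e70) (-e41) (-e42) (-e51) (-e53)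
        (-e62) (-e63) (-e71) (-e72) (-e73) (-e74) (-e75) (-e76) := by
  simp [lowerMat]

/-- The surviving entry is the sum over the six maximal chains from 000 to 111; a fourth factor has
no chain left. -/
theorem lowerMat_zero_pow_three
    (e10 e20 e30 e40 e50 e60 e70 e41 e42 e51 e53 e62 e63 e71 e72 e73 e74 e75 e76 : ℂ) :
    lowerMat 0 e10 e20 e30 e40 e50 e60 e70 e41 e42 e51 e53 e62 e63 e71 e72 e73 e74 e75 e76 ^ 3 =
      lowerMat 0 0 0 0 0 0 0
        (e74 * (e41 * e10 + e42 * e20) + e75 * (e51 * e10 + e53 * e30)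
          + e76 * (e62 * e20 + e63 * e30)) 0 0 0 0 0 0 0 0 0 0 0 0 := by
  rw [pow_succ, pow_two, lowerMat_mul, lowerMat_mul]
  congr 1 <;> ring

theorem lowerMat_zero_pow_four
    (e10 e20 e30 e40 e50 e60 e70 e41 e42 e51 e53 e62 e63 e71 e72 e73 e74 e75 e76 : ℂ) :
    lowerMat 0 e10 e20 e30 e40 e50 e60 e70 e41 e42 e51 e53 e62 e63 e71 e72 e73 e74 e75 e76 ^ 4 =
      0 := by
  have h0 : lowerMat 0 0 0 0 0 0 0 0 0 0 0 0 0 0 0 0 0 0 0 0 = 0 := by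
    ext i j
    fin_cases i <;> fin_cases j <;> simp [lowerMat]
  rw [pow_succ, lowerMat_zero_pow_three, lowerMat_mul, ← h0]
  congr 1 <;> ring

theorem isUnit_lowerMat_one
    (e10 e20 e30 e40 e50 e60 e70 e41 e42 e51 e53 e62 e63 e71 e72 e73 e74 e75 e76 : ℂ) :
    IsUnit (lowerMat 1 e10 e20 e30 e40 e50 e60 e70 e41 e42 e51 e53 e62 e63 e71 e72 e73 e74 e75
      e76) := by
  rw [lowerMat_one_eq]
  exact IsNilpotent.isUnit_one_add ⟨4, lowerMat_zero_pow_four ..⟩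

/-- The logarithm of a Cayley transform of a nilpotent matrix is `2 artanh`. -/
theorem unipotentLog_cayley {q : Matrix (Fin 8) (Fin 8) ℂ} (hq : q ^ 4 = 0) :
    unipotentLog ((1 + q) * (1 - q)⁻¹) = (2 : ℂ) • q + (2 / 3 : ℂ) • q ^ 3 := by
  have hinv : (1 - q)⁻¹ = 1 + q + q ^ 2 + q ^ 3 := by
    apply Matrix.inv_eq_right_inv
    have : (1 - q) * (1 + q + q ^ 2 + q ^ 3) = 1 - q ^ 4 := by noncomm_ring
    rw [this, hq, sub_zero]
  have hB : (1 + q) * (1 - q)⁻¹ - 1 = (2 : ℂ) • (q + q ^ 2 + q ^ 3) := by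
    have : (1 + q) * (1 + q + q ^ 2 + q ^ 3) - 1 = (q + q ^ 2 + q ^ 3) + (q + q ^ 2 + q ^ 3)
        + q ^ 4 := by
      noncomm_ring
    rw [hinv, this, hq, add_zero, two_smul]
  have h2 : (q + q ^ 2 + q ^ 3) ^ 2 = q ^ 2 + (2 : ℂ) • q ^ 3 := by
    have : (q + q ^ 2 + q ^ 3) ^ 2 = q ^ 2 + (q ^ 3 + q ^ 3)
        + q ^ 4 * (3 + q + q + q ^ 2) := by
      noncomm_ring
    rw [this, hq, zero_mul, add_zero, two_smul]
  have h3 : (q + q ^ 2 + q ^ 3) ^ 3 = q ^ 3 := by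
    have : (q + q ^ 2 + q ^ 3) ^ 3 = q ^ 3
        + q ^ 4 * (3 + 6 * q + 7 * q ^ 2 + 6 * q ^ 3 + 3 * q ^ 4 + q ^ 5) := by
      noncomm_ring
    rw [this, hq, zero_mul, add_zero]
  rw [unipotentLog, hB, smul_pow, smul_pow, h2, h3]
  module

theorem tau_mul (a b : ℂ) : tau a * tau b = tau (a * b) := by
  simp [tau, mul_pow]

theorem tau_one : tau 1 = 1 := by simp [tau]

theorem tau_map_conj (c : ℂ) : (tau c).map (starRingEnd ℂ) = tau (starRingEnd ℂ c) := by
  rw [tau, Matrix.diagonal_map (map_zero _)]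
  simp [tau]

theorem tau_conj_lowerMat
    (e10 e20 e30 e40 e50 e60 e70 e41 e42 e51 e53 e62 e63 e71 e72 e73 e74 e75 e76 : ℂ) :
    tau Complex.I *
      lowerMat 1 e10 e20 e30 e40 e50 e60 e70 e41 e42 e51 e53 e62 e63 e71 e72 e73 e74 e75 e76 *
      tau (-Complex.I) =
    lowerMat 1 (Complex.I * e10) (Complex.I * e20) (Complex.I * e30) (-e40) (-e50) (-e60)
      (-Complex.I * e70) (Complex.I * e41) (Complex.I * e42) (Complex.I * e51) (Complex.I * e53)
      (Complex.I * e62) (Complex.I * e63) (-e71) (-e72) (-e73) (Complex.I * e74)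
      (Complex.I * e75) (Complex.I * e76) := by
  have h2 : (-Complex.I) ^ 3 = Complex.I := by 
    rw [Odd.neg_pow (by decide), Complex.I_pow_three, neg_neg]
  have h3 : Complex.I ^ 3 = -Complex.I := Complex.I_pow_three
  rw [tau, tau]
  ext i j
  rw [Matrix.mul_diagonal, Matrix.diagonal_mul]
  fin_cases i <;> fin_cases j <;>
    simp [lowerMat, weight, h2, h3] <;> ring_nf <;> simp

theorem lowerMat_map_conj
    (e10 e20 e30 e40 e50 e60 e70 e41 e42 e51 e53 e62 e63 e71 e72 e73 e74 e75 e76 : ℂ) :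
    (lowerMat 1 e10 e20 e30 e40 e50 e60 e70 e41 e42 e51 e53 e62 e63 e71 e72 e73 e74 e75 e76).map
        (starRingEnd ℂ) =
      lowerMat 1 (starRingEnd ℂ e10) (starRingEnd ℂ e20) (starRingEnd ℂ e30) (starRingEnd ℂ e40)
        (starRingEnd ℂ e50) (starRingEnd ℂ e60) (starRingEnd ℂ e70) (starRingEnd ℂ e41)
        (starRingEnd ℂ e42) (starRingEnd ℂ e51) (starRingEnd ℂ e53) (starRingEnd ℂ e62)
        (starRingEnd ℂ e63) (starRingEnd ℂ e71) (starRingEnd ℂ e72) (starRingEnd ℂ e73)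
        (starRingEnd ℂ e74) (starRingEnd ℂ e75) (starRingEnd ℂ e76) := by
  ext i j
  fin_cases i <;> fin_cases j <;> simp [lowerMat]

/-- The single-valued matrix attached to `M = L τ(2πi)` in terms of `N = τ(i) L τ(-i)`. -/
theorem tau_mul_inv_conj (L : Matrix (Fin 8) (Fin 8) ℂ) :
    tau Complex.I * (L * tau (2 * Real.pi * Complex.I)) *
        ((L * tau (2 * Real.pi * Complex.I)).map (starRingEnd ℂ))⁻¹ * tau Complex.I =
      (tau Complex.I * L * tau (-Complex.I)) *
        ((tau Complex.I * L * tau (-Complex.I)).map (starRingEnd ℂ))⁻¹ := by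
  set N := tau Complex.I * L * tau (-Complex.I) with hN
  have hI : tau Complex.I * tau (-Complex.I) = 1 := by
    rw [tau_mul, mul_neg, Complex.I_mul_I, neg_neg, tau_one]
  have hI' : tau (-Complex.I) * tau Complex.I = 1 := by
    rw [tau_mul, neg_mul, Complex.I_mul_I, neg_neg, tau_one]
  have hpi : tau (-(2 * Real.pi)) * tau (-(2 * Real.pi))⁻¹ = 1 := by
    rw [tau_mul, mul_inv_cancel₀ (by simp [Real.pi_ne_zero]), tau_one]
  -- Writing 2πi = (-i)(-2π) splits off the real factor τ(-2π), which conjugation fixes and which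
  -- cancels in M M̄⁻¹.
  have hM : L * tau (2 * Real.pi * Complex.I) = tau (-Complex.I) * N * tau (-(2 * Real.pi)) := by
    have e : tau (2 * Real.pi * Complex.I) = tau (-Complex.I) * tau (-(2 * Real.pi)) := by
      rw [tau_mul]; congr 1; ring
    rw [hN, e]
    simp only [← mul_assoc, hI', one_mul]
  have hMc : (L * tau (2 * Real.pi * Complex.I)).map (starRingEnd ℂ) =
      tau Complex.I * N.map (starRingEnd ℂ) * tau (-(2 * Real.pi)) := by
    rw [hM, Matrix.map_mul, Matrix.map_mul, tau_map_conj, tau_map_conj]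
    simp [map_ofNat (starRingEnd ℂ) 2]
  rw [hMc, hM, Matrix.mul_inv_rev, Matrix.mul_inv_rev, Matrix.inv_eq_right_inv hI,
    Matrix.inv_eq_right_inv hpi]
  calc _ = (tau Complex.I * tau (-Complex.I)) * N * (tau (-(2 * Real.pi)) * tau (-(2 * Real.pi))⁻¹)
        * (N.map (starRingEnd ℂ))⁻¹ * (tau (-Complex.I) * tau Complex.I) := by
        simp only [mul_assoc]
    _ = _ := by rw [hI, hI', hpi, one_mul, mul_one, mul_one]

/-- With N = τ(i) L τ(-i), the conditions N = (1 + q)A, A real and q imaginary, force A = Re N and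
qA = i Im N. Solving the latter entry by entry, A being unitriangular, gives the `q` below. -/
theorem neg_half_mul_unipotentLog_apply
    (e10 e20 e30 e40 e50 e60 e70 e41 e42 e51 e53 e62 e63 e71 e72 e73 e74 e75 e76 : ℂ)
    {L : Matrix (Fin 8) (Fin 8) ℂ}
    (hL : L = lowerMat 1 e10 e20 e30 e40 e50 e60 e70 e41 e42 e51 e53 e62 e63 e71 e72 e73 e74 e75
      e76) :
    -1 / (2 * Complex.I) * unipotentLog (tau Complex.I * (L * tau (2 * Real.pi * Complex.I)) *
        ((L * tau (2 * Real.pi * Complex.I)).map (starRingEnd ℂ))⁻¹ * tau Complex.I) 7 0 =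
      ((e70.re - e74.re * e40.re - e75.re * e50.re - e76.re * e60.re
        + (e71.im - e74.re * e41.im - e75.re * e51.im) * e10.im
        + (e72.im - e74.re * e42.im - e76.re * e62.im) * e20.im
        + (e73.im - e75.re * e53.im - e76.re * e63.im) * e30.im
        + 1 / 3 * (e74.re * (e41.re * e10.re + e42.re * e20.re)
          + e75.re * (e51.re * e10.re + e53.re * e30.re)
          + e76.re * (e62.re * e20.re + e63.re * e30.re)) : ℝ) : ℂ) := by
  set t71 : ℝ := -e71.im + e74.re * e41.im + e75.re * e51.im with h71
  set t72 : ℝ := -e72.im + e74.re * e42.im + e76.re * e62.im with h72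
  set t73 : ℝ := -e73.im + e75.re * e53.im + e76.re * e63.im with h73
  set q : Matrix (Fin 8) (Fin 8) ℂ := lowerMat 0
    (Complex.I * e10.re) (Complex.I * e20.re) (Complex.I * e30.re)
    (Complex.I * (-e40.im + e41.re * e10.im + e42.re * e20.im : ℝ))
    (Complex.I * (-e50.im + e51.re * e10.im + e53.re * e30.im : ℝ))
    (Complex.I * (-e60.im + e62.re * e20.im + e63.re * e30.im : ℝ))
    (Complex.I * (-e70.re + e74.re * e40.re + e75.re * e50.re + e76.re * e60.re
      + t71 * e10.im + t72 * e20.im + t73 * e30.im : ℝ))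
    (Complex.I * e41.re) (Complex.I * e42.re) (Complex.I * e51.re) (Complex.I * e53.re)
    (Complex.I * e62.re) (Complex.I * e63.re) (Complex.I * t71) (Complex.I * t72)
    (Complex.I * t73) (Complex.I * e74.re) (Complex.I * e75.re) (Complex.I * e76.re) with hq
  set A : Matrix (Fin 8) (Fin 8) ℂ := lowerMat 1
    (-e10.im : ℝ) (-e20.im : ℝ) (-e30.im : ℝ) (-e40.re : ℝ) (-e50.re : ℝ) (-e60.re : ℝ)
    (e70.im : ℝ) (-e41.im : ℝ) (-e42.im : ℝ) (-e51.im : ℝ) (-e53.im : ℝ) (-e62.im : ℝ)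
    (-e63.im : ℝ) (-e71.re : ℝ) (-e72.re : ℝ) (-e73.re : ℝ) (-e74.im : ℝ) (-e75.im : ℝ)
    (-e76.im : ℝ) with hA
  have hq4 : q ^ 4 = 0 := lowerMat_zero_pow_four ..
  have hN : tau Complex.I * L * tau (-Complex.I) = (1 + q) * A := by
    rw [hL, tau_conj_lowerMat, hq, ← lowerMat_one_eq, hA, lowerMat_mul]
    congr 1 <;> apply Complex.ext <;> simp [h71, h72, h73] <;> ring
  have hNc : (tau Complex.I * L * tau (-Complex.I)).map (starRingEnd ℂ) = (1 - q) * A := by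
    rw [hN, Matrix.map_mul, hq, sub_eq_add_neg, neg_lowerMat_zero, ← lowerMat_one_eq,
      ← lowerMat_one_eq, lowerMat_map_conj, hA, lowerMat_map_conj]
    simp only [map_mul, Complex.conj_I, Complex.conj_ofReal, neg_mul]
  have hAu : A * A⁻¹ = 1 :=
    Matrix.mul_nonsing_inv _ ((Matrix.isUnit_iff_isUnit_det _).1 (isUnit_lowerMat_one ..))
  rw [tau_mul_inv_conj, hNc, hN, Matrix.mul_inv_rev]
  have : (1 + q) * A * (A⁻¹ * (1 - q)⁻¹) = (1 + q) * (1 - q)⁻¹ := by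
    rw [mul_assoc, ← mul_assoc A, hAu, one_mul]
  rw [this, unipotentLog_cayley hq4, hq, lowerMat_zero_pow_three]
  simp only [lowerMat, Matrix.add_apply, Matrix.smul_apply, smul_eq_mul]
  simp only [Matrix.of_apply, Matrix.cons_val, h71, h72, h73]
  field_simp
  push_cast
  ring_nf
  simp only [Complex.I_sq]
  ring

/-! ### Existence of paths -/

/-- Two points of the plane can be joined by a smooth arc avoiding a given finite set of other
points. -/
theorem exists_path_avoiding {a b : ℂ} (hab : a ≠ b) {S : Set ℂ} (hS : S.Finite)
    (ha : a ∉ S) (hb : b ∉ S) :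
    ∃ γ : ℝ → ℂ, ContDiff ℝ 1 γ ∧ γ 0 = a ∧ γ 1 = b ∧ ∀ u : ℝ, γ u ∉ S := by
  have hba : b - a ≠ 0 := sub_ne_zero.2 hab.symm
  -- In the coordinate taking a, b to 0, 1, the arcs are the parabolas u + i l u(1-u). A point other
  -- than a and b lies on at most one of them, with l equal to this quotient, so only finitely many
  -- l are bad.
  have hbad : ((fun m : ℂ => ((m - a) / (b - a)).im /
      (((m - a) / (b - a)).re * (1 - ((m - a) / (b - a)).re))) '' S).Finite := hS.image _
  obtain ⟨l, hl⟩ := hbad.infinite_compl.nonempty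
  have hof : ContDiff ℝ 1 (fun u : ℝ => (u : ℂ)) := Complex.ofRealCLM.contDiff
  refine ⟨fun u => a + (b - a) * (u + l * (u * (1 - u)) * Complex.I), by fun_prop, by simp,
    by simp, fun u hu => ?_⟩
  set m := a + (b - a) * (u + l * (u * (1 - u)) * Complex.I) with hm
  have hq : (m - a) / (b - a) = u + (l * (u * (1 - u)) : ℝ) * Complex.I := by
    rw [hm, add_sub_cancel_left, mul_div_cancel_left₀ _ hba]
    push_cast
    ring
  have hre : ((m - a) / (b - a)).re = u := by rw [hq]; simp
  have him : ((m - a) / (b - a)).im = l * (u * (1 - u)) := by rw [hq]; simp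
  have hu0 : u ≠ 0 := by
    rintro rfl
    exact ha (by simpa [hm] using hu)
  have hu1 : 1 - u ≠ 0 := by
    intro h
    obtain rfl : u = 1 := by linarith
    exact hb (by simpa [hm] using hu)
  exact hl ⟨m, hu, by simp only [hre, him]; field_simp⟩

section system

variable {x y z : ℂ} (hx : x ≠ 0) (hy : y ≠ 0) (hz : z ≠ 0) (hx1 : x ≠ 1) (hy1 : y ≠ 1)
  (hz1 : z ≠ 1) (hxy : x * y ≠ 1) (hyz : y * z ≠ 1) (hxyz : x * y * z ≠ 1)

include hx hy hz hx1 hy1 hz1 hxy hyz hxyz in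
theorem nodes_injective : Function.Injective (nodes x y z) := by
  have hyz0 : y * z ≠ 0 := mul_ne_zero hy hz
  have hxyz0 : x * y * z ≠ 0 := mul_ne_zero (mul_ne_zero hx hy) hz
  have h12 : (x * y * z)⁻¹ ≠ (y * z)⁻¹ := fun h => hx1 (by
    have := inv_injective h
    rw [mul_assoc] at this
    exact (mul_eq_right₀ hyz0).1 this)
  have h13 : (x * y * z)⁻¹ ≠ z⁻¹ := fun h => hxy ((mul_eq_right₀ hz).1 (inv_injective h))
  have h23 : (y * z)⁻¹ ≠ z⁻¹ := fun h => hy1 ((mul_eq_right₀ hz).1 (inv_injective h))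
  have h14 : (x * y * z)⁻¹ ≠ 1 := fun h => hxyz (inv_eq_one.1 h)
  have h24 : (y * z)⁻¹ ≠ 1 := fun h => hyz (inv_eq_one.1 h)
  have h34 : z⁻¹ ≠ 1 := fun h => hz1 (inv_eq_one.1 h)
  have h01 : (0 : ℂ) ≠ (x * y * z)⁻¹ := (inv_ne_zero hxyz0).symm
  have h02 : (0 : ℂ) ≠ (y * z)⁻¹ := (inv_ne_zero hyz0).symm
  have h03 : (0 : ℂ) ≠ z⁻¹ := (inv_ne_zero hz).symm
  intro i j hij
  by_contra hne
  fin_cases i <;> fin_cases j <;> simp only [nodes] at hij <;>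
    first
    | exact hne rfl
    | exact h01 hij | exact h02 hij | exact h03 hij | exact zero_ne_one hij
    | exact h12 hij | exact h13 hij | exact h14 hij | exact h23 hij | exact h24 hij
    | exact h34 hij
    | exact h01 hij.symm | exact h02 hij.symm | exact h03 hij.symm | exact zero_ne_one hij.symm
    | exact h12 hij.symm | exact h13 hij.symm | exact h14 hij.symm | exact h23 hij.symm
    | exact h24 hij.symm | exact h34 hij.symm

include hx hy hz hx1 hy1 hz1 hxy hyz hxyz in
theorem exists_isPathSystem : ∃ p, IsPathSystem x y z p := by
  have hinj := nodes_injective hx hy hz hx1 hy1 hz1 hxy hyz hxyz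
  have h : ∀ s t : Fin 5, ∃ γ, s < t → IsPath (nodes x y z) s t γ := by
    intro s t
    by_cases hst : s < t
    · obtain ⟨γ, h1, h2, h3, h4⟩ := exists_path_avoiding (hinj.ne hst.ne)
        (S := nodes x y z '' Set.Ioo s t) (Set.toFinite _)
        (by rintro ⟨m, hm, h⟩; exact hm.1.ne' (hinj h))
        (by rintro ⟨m, hm, h⟩; exact hm.2.ne (hinj h))
      exact ⟨γ, fun _ => ⟨h1, h2, h3, fun u _ m hsm hmt h => h4 u ⟨m, ⟨hsm, hmt⟩, h.symm⟩⟩⟩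
    · exact ⟨fun _ => 0, fun h => absurd h hst⟩
  choose γ hγ using h
  exact ⟨fun _ s t => γ s t, fun _ s t hst => hγ s t hst⟩

end system

/-! ### Evaluation of the entries of the variation matrix -/

theorem J_one (γ : ℝ → ℂ) (a : ℂ) : J γ [a] = -iterInt γ [a] 1 := by simp [J]

theorem J_two (γ : ℝ → ℂ) (a b : ℂ) : J γ [a, b] = iterInt γ [a, b] 1 := by simp [J]

theorem J_three (γ : ℝ → ℂ) (a b c : ℂ) : J γ [a, b, c] = -iterInt γ [a, b, c] 1 := by
  simp [J, pow_succ]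

theorem re_J_one {γ : ℝ → ℂ} (hγ : ContDiff ℝ 1 γ) {a : ℂ} (ha : Avoids γ a) :
    (J γ [a]).re = Real.log ‖γ 0 - a‖ - Real.log ‖γ 1 - a‖ := by
  rw [J_one, Complex.neg_re, re_iterInt_one hγ ⟨zero_le_one, le_rfl⟩ ha]
  ring

theorem IsPath.avoids_node {a : Fin 5 → ℂ} {s t : Fin 5} {γ : ℝ → ℂ} (h : IsPath a s t γ)
    (m : Fin 5) (hsm : s < m) (hmt : m < t) : Avoids γ (a m) :=
  fun u hu => h.avoids u hu m hsm hmt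

theorem svLi111_eq {x y z : ℂ} (hx : x ≠ 0) (hy : y ≠ 0) (hz : z ≠ 0)
    (hx1 : x ≠ 1) (hy1 : y ≠ 1) (hz1 : z ≠ 1)
    (hxy : x * y ≠ 1) (hyz : y * z ≠ 1) (hxyz : x * y * z ≠ 1)
    {p : Fin 8 → Fin 5 → Fin 5 → ℝ → ℂ} (hp : IsPathSystem x y z p) :
    svLi111 x y z p = ((svLi3 (arg₁ x y z) + svLi3 (y / (y - 1)) + svLi3 (x * y)
        - svLi3 (arg₂ x y z) - svLi3 (arg₃ x y z) - svLi3 (arg₄ y z)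
        - svLi3 ((y - x * y) / (y - 1)) + svLi3 (1 - x) : ℝ) : ℂ) := by
  have hx1' : 1 - x ≠ 0 := sub_ne_zero.2 hx1.symm
  have hy1' : 1 - y ≠ 0 := sub_ne_zero.2 hy1.symm
  have hy1'' : y - 1 ≠ 0 := sub_ne_zero.2 hy1
  have hz1' : 1 - z ≠ 0 := sub_ne_zero.2 hz1.symm
  have hxy' : 1 - x * y ≠ 0 := sub_ne_zero.2 hxy.symm
  have hyz' : 1 - y * z ≠ 0 := sub_ne_zero.2 hyz.symm
  have hxyz' : 1 - x * y * z ≠ 0 := sub_ne_zero.2 hxyz.symm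
  have hyz0 : y * z ≠ 0 := mul_ne_zero hy hz
  have hxy0 : x * y ≠ 0 := mul_ne_zero hx hy
  have hxyz0 : x * y * z ≠ 0 := mul_ne_zero hxy0 hz
  have hone : (1 : ℝ) ∈ Set.Icc (0 : ℝ) 1 := ⟨zero_le_one, le_rfl⟩
  -- the points and their distances
  set a₁ := nodes x y z 1 with ha₁
  set a₂ := nodes x y z 2 with ha₂
  set a₃ := nodes x y z 3 with ha₃
  have e₀ : nodes x y z 0 = 0 := rfl
  have e₁ : a₁ = (x * y * z)⁻¹ := rfl
  have e₂ : a₂ = (y * z)⁻¹ := rfl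
  have e₃ : a₃ = z⁻¹ := rfl
  have e₄ : nodes x y z 4 = 1 := rfl
  have n₁ : Real.log ‖0 - a₁‖ = -(Real.log ‖x‖ + Real.log ‖y‖ + Real.log ‖z‖) := by
    rw [e₁, zero_sub, norm_neg, norm_inv, Real.log_inv, log_norm_mul hxy0 hz, log_norm_mul hx hy]
  have n₂ : Real.log ‖0 - a₂‖ = -(Real.log ‖y‖ + Real.log ‖z‖) := by
    rw [e₂, zero_sub, norm_neg, norm_inv, Real.log_inv, log_norm_mul hy hz]
  have n₃ : Real.log ‖0 - a₃‖ = -Real.log ‖z‖ := by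
    rw [e₃, zero_sub, norm_neg, norm_inv, Real.log_inv]
  have m₁ : Real.log ‖1 - a₁‖ =
      Real.log ‖1 - x * y * z‖ - (Real.log ‖x‖ + Real.log ‖y‖ + Real.log ‖z‖) := by
    rw [← log_norm_mul hx hy, ← log_norm_mul hxy0 hz, ← log_norm_div hxyz' hxyz0, e₁,
      ← norm_neg]
    congr 2
    field_simp
    ring
  have m₂ : Real.log ‖1 - a₂‖ = Real.log ‖1 - y * z‖ - (Real.log ‖y‖ + Real.log ‖z‖) := by
    rw [← log_norm_mul hy hz, ← log_norm_div hyz' hyz0, e₂, ← norm_neg]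
    congr 2
    field_simp
    ring
  have m₃ : Real.log ‖1 - a₃‖ = Real.log ‖1 - z‖ - Real.log ‖z‖ := by
    rw [← log_norm_div hz1' hz, e₃, ← norm_neg]
    congr 2
    field_simp
    ring
  have d₁₂ : Real.log ‖a₁ - a₂‖ =
      Real.log ‖1 - x‖ - (Real.log ‖x‖ + Real.log ‖y‖ + Real.log ‖z‖) := by
    rw [← log_norm_mul hx hy, ← log_norm_mul hxy0 hz, ← log_norm_div hx1' hxyz0, e₁, e₂]
    congr 2
    field_simp
  have d₁₃ : Real.log ‖a₁ - a₃‖ =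
      Real.log ‖1 - x * y‖ - (Real.log ‖x‖ + Real.log ‖y‖ + Real.log ‖z‖) := by
    rw [← log_norm_mul hx hy, ← log_norm_mul hxy0 hz, ← log_norm_div hxy' hxyz0, e₁, e₃]
    congr 2
    field_simp
  have d₂₃ : Real.log ‖a₂ - a₃‖ = Real.log ‖1 - y‖ - (Real.log ‖y‖ + Real.log ‖z‖) := by
    rw [← log_norm_mul hy hz, ← log_norm_div hy1' hyz0, e₂, e₃]
    congr 2
    field_simp
  -- the paths
  have p0 := hp 0 0 4 (by decide)
  have p1 := hp 1 0 3 (by decide)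
  have p20 := hp 2 0 2 (by decide)
  have p22 := hp 2 2 4 (by decide)
  have p3 := hp 3 1 4 (by decide)
  have p4 := hp 4 0 2 (by decide)
  have p5 := hp 5 1 3 (by decide)
  have p6 := hp 6 2 4 (by decide)
  have v01 := p0.avoids_node 1 (by decide) (by decide)
  have v02 := p0.avoids_node 2 (by decide) (by decide)
  have v03 := p0.avoids_node 3 (by decide) (by decide)
  have v11 := p1.avoids_node 1 (by decide) (by decide)
  have v12 := p1.avoids_node 2 (by decide) (by decide)
  have v201 := p20.avoids_node 1 (by decide) (by decide)
  have v223 := p22.avoids_node 3 (by decide) (by decide)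
  have v32 := p3.avoids_node 2 (by decide) (by decide)
  have v33 := p3.avoids_node 3 (by decide) (by decide)
  have v41 := p4.avoids_node 1 (by decide) (by decide)
  have v52 := p5.avoids_node 2 (by decide) (by decide)
  have v63 := p6.avoids_node 3 (by decide) (by decide)
  -- weight one
  have r10 : (J (p 0 0 4) [a₃]).re = -Real.log ‖1 - z‖ := by
    rw [re_J_one p0.contDiff v03, p0.source, p0.target, e₀, e₄, ← ha₃, n₃, m₃]; ring
  have r20 : (J (p 0 0 4) [a₂]).re = -Real.log ‖1 - y * z‖ := by
    rw [re_J_one p0.contDiff v02, p0.source, p0.target, e₀, e₄, ← ha₂, n₂, m₂]; ring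
  have r30 : (J (p 0 0 4) [a₁]).re = -Real.log ‖1 - x * y * z‖ := by
    rw [re_J_one p0.contDiff v01, p0.source, p0.target, e₀, e₄, ← ha₁, n₁, m₁]; ring
  have r41 : (J (p 1 0 3) [a₂]).re = -Real.log ‖1 - y‖ := by
    rw [re_J_one p1.contDiff v12, p1.source, p1.target, e₀, ← ha₂, ← ha₃, norm_sub_rev a₃,
      n₂, d₂₃]; ring
  have r51 : (J (p 1 0 3) [a₁]).re = -Real.log ‖1 - x * y‖ := by
    rw [re_J_one p1.contDiff v11, p1.source, p1.target, e₀, ← ha₁, ← ha₃, norm_sub_rev a₃,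
      n₁, d₁₃]; ring
  have r42 : (J (p 2 2 4) [a₃]).re = -(Real.log ‖1 - z‖ + Real.log ‖y‖ - Real.log ‖1 - y‖) := by
    rw [re_J_one p22.contDiff v223, p22.source, p22.target, e₄, ← ha₂, ← ha₃, m₃, d₂₃]; ring
  have r62 : (J (p 2 0 2) [a₁]).re = -Real.log ‖1 - x‖ := by
    rw [re_J_one p20.contDiff v201, p20.source, p20.target, e₀, ← ha₁, ← ha₂, norm_sub_rev a₂,
      n₁, d₁₂]; ring
  have r53 : (J (p 3 1 4) [a₃]).re =
      -(Real.log ‖1 - z‖ + (Real.log ‖x‖ + Real.log ‖y‖ - Real.log ‖1 - x * y‖)) := by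
    rw [re_J_one p3.contDiff v33, p3.source, p3.target, e₄, ← ha₁, ← ha₃, m₃, d₁₃]; ring
  have r63 : (J (p 3 1 4) [a₂]).re =
      -(Real.log ‖1 - y * z‖ + (Real.log ‖x‖ - Real.log ‖1 - x‖)) := by
    rw [re_J_one p3.contDiff v32, p3.source, p3.target, e₄, ← ha₁, ← ha₂, m₂, d₁₂]; ring
  have r74 : (J (p 4 0 2) [a₁]).re = -Real.log ‖1 - x‖ := by
    rw [re_J_one p4.contDiff v41, p4.source, p4.target, e₀, ← ha₁, ← ha₂, norm_sub_rev a₂,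
      n₁, d₁₂]; ring
  have r75 : (J (p 5 1 3) [a₂]).re =
      -(Real.log ‖x‖ + Real.log ‖1 - y‖ - Real.log ‖1 - x‖) := by
    rw [re_J_one p5.contDiff v52, p5.source, p5.target, ← ha₁, ← ha₂, ← ha₃, norm_sub_rev a₃,
      d₂₃, d₁₂]; ring
  have r76 : (J (p 6 2 4) [a₃]).re = -(Real.log ‖1 - z‖ + Real.log ‖y‖ - Real.log ‖1 - y‖) := by
    rw [re_J_one p6.contDiff v63, p6.source, p6.target, e₄, ← ha₂, ← ha₃, m₃, d₂₃]; ring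
  -- weight two
  have hD : blochWigner (arg₂ x y (z * a₃)) = blochWigner ((1 - x) / (x * (y - 1))) := by
    have h : arg₂ x y (z * a₃) = 1 - ((1 - x) / (x * (y - 1)))⁻¹ := by
      rw [e₃, mul_inv_cancel₀ hz, arg₂, inv_div]
      field_simp
      ring
    rw [h, blochWigner_one_sub, blochWigner_inv, neg_neg]
  have t71 := im_iterInt_inv_inv hx hy hz hx1 p1.contDiff p1.source v11 v12 hone
  have t73 := im_iterInt_two p3.contDiff hone (b := a₂) (c := a₃)
    (fun h => by
      have := nodes_injective hx hy hz hx1 hy1 hz1 hxy hyz hxyz h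
      exact absurd this (by decide)) v32 v33
  have w₁ : (1 - a₂) / (a₃ - a₂) = 1 - arg₄ y z := by
    have h32 : a₃ - a₂ = (y - 1) / (y * z) := by
      rw [e₂, e₃]
      field_simp
    rw [h32, e₂, arg₄]
    field_simp
    ring
  have w₂ : (a₁ - a₂) / (a₃ - a₂) = (1 - x) / (x * (y - 1)) := by
    have h32 : a₃ - a₂ = (y - 1) / (y * z) := by
      rw [e₂, e₃]
      field_simp
    rw [h32, e₁, e₂]
    field_simp
  rw [p1.target, ← ha₃, ← e₁, ← e₂, hD, e₃, mul_inv_cancel_right₀ hz] at t71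
  rw [p3.source, p3.target, ← ha₁, e₄, w₁, w₂, m₃, d₁₂, norm_sub_rev a₃, d₂₃,
    blochWigner_one_sub] at t73
  -- weight three
  have h3 := re_iterInt_three hx hy hz hx1 hy1 hxy p0.contDiff p0.source v01 v02 v03 hone
  rw [tripleDefect, p0.target, e₄, ← e₁, ← e₂, ← e₃, mul_one, mul_one, mul_one] at h3
  rw [svLi111, matB, matM, neg_half_mul_unipotentLog_apply _ _ _ _ _ _ _ _ _ _ _ _ _ _ _ _ _ _ _
    (rfl : matL x y z p = lowerMat 1 (J (p 0 0 4) [a₃]) (J (p 0 0 4) [a₂]) (J (p 0 0 4) [a₁])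
      (J (p 0 0 4) [a₂, a₃]) (J (p 0 0 4) [a₁, a₃]) (J (p 0 0 4) [a₁, a₂])
      (J (p 0 0 4) [a₁, a₂, a₃]) (J (p 1 0 3) [a₂]) (J (p 2 2 4) [a₃]) (J (p 1 0 3) [a₁])
      (J (p 3 1 4) [a₃]) (J (p 2 0 2) [a₁]) (J (p 3 1 4) [a₂]) (J (p 1 0 3) [a₁, a₂])
      (J (p 2 0 2) [a₁] * J (p 2 2 4) [a₃]) (J (p 3 1 4) [a₂, a₃]) (J (p 4 0 2) [a₁])
      (J (p 5 1 3) [a₂]) (J (p 6 2 4) [a₃]))]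
  congr 1
  rw [Complex.mul_im]
  -- Entry (111,010) is a product, and its simple factors have the same real parts as entries
  -- (111,011) and (111,110); hence the coefficient of Im E₀₁₀,₀₀₀ vanishes.
  rw [r10, r20, r30, r41, r51, r42, r62, r53, r63, r74, r75, r76]
  simp only [J_one, J_two, J_three, Complex.neg_re, Complex.neg_im]
  -- The remaining path-dependent quantities are integrals along the single path `p 0 0 4`, and `h3`
  -- was taken along that same path, so they cancel.
  linear_combination -h3 - (iterInt (p 0 0 4) [a₃] 1).im * t71 -
    (iterInt (p 0 0 4) [a₁] 1).im * t73

end TripleLog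

theorem mainTheorem9 (x y z : ℂ)
    (hx : x ≠ 0) (hy : y ≠ 0) (hz : z ≠ 0)
    (hx1 : x ≠ 1) (hy1 : y ≠ 1) (hz1 : z ≠ 1)
    (hxy : x * y ≠ 1) (hyz : y * z ≠ 1) (hxyz : x * y * z ≠ 1) :
    (∃ p, TripleLog.IsPathSystem x y z p) ∧
    ∀ p, TripleLog.IsPathSystem x y z p →
      TripleLog.svLi111 x y z p =
        ((TripleLog.svLi3 ((y - 1) * (1 - x * y * z) / (y * (1 - x) * (1 - z)))
          + TripleLog.svLi3 (y / (y - 1))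
          + TripleLog.svLi3 (x * y)
          - TripleLog.svLi3 ((1 - x * y * z) / (1 - x))
          - TripleLog.svLi3 ((1 - x * y * z) / (x * y * (1 - z)))
          - TripleLog.svLi3 ((y - y * z) / (y - 1))
          - TripleLog.svLi3 ((y - x * y) / (y - 1))
          + TripleLog.svLi3 (1 - x) : ℝ) : ℂ) :=
  ⟨TripleLog.exists_isPathSystem hx hy hz hx1 hy1 hz1 hxy hyz hxyz, fun _ hp =>
    TripleLog.svLi111_eq hx hy hz hx1 hy1 hz1 hxy hyz hxyz hp⟩
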